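/- Let $1\le d\le n$, $n\ge 2$, and let $\mathbb G_{d,n}$ be the Grassmannian of $d$-dimensional subspaces of $\mathbb R^n$, a subspace $S$ being identified with the orthogonal projection onto it, with distance $\|S-T\|$ (operator norm). A $d$-varifold is a nonnegative Radon measure $V$ on $\mathbb R^n\times\mathbb G_{d,n}$; its mass measure is $\|V\|(A)=V(A\times\mathbb G_{d,n})$. **Definitions.** For a $C^1$ diffeomorphism $f$ of $\mathbb R^n$, the push-forward $f_\#V$ is given by $f_\#V(g)=\int g(f(x),Df(x)(S))\,J_Sf(x)\,dV(x,S)$ with $J_Sf(x)=\det(Y^tY)^{1/2}$, $Y=Df(x)|_S$. For $\varphi\in C^1(\mathbb R^n,\mathbb R)$, $X\in C^1(\mathbb R^n,\mathbb R^n)$ the weighted first variation is $$\delta(V,\varphi)(X)=\int \varphi(x)\,\mathrm{tr}\big(S\,DX(x)\big)\,dV(x,S)+\int\nabla\varphi(x)\cdot X(x)\,dV(x,S).$$ Fix a radially symmetric $\psi\in C^\infty(\mathbb R^n)$ with $0\le\psi\le1$, $\psi(x)=1$ for $|x|\le\frac12$ and $\psi(x)=0$ for $|x|\ge1$. For $\epsilon\in(0,1)$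 let $\hat\Phi_\epsilon(x)=(2\pi\epsilon^2)^{-n/2}e^{-|x|^2/(2\epsilon^2)}$ and $\Phi_\epsilon=c(\epsilon)\,\psi\,\hat\Phi_\epsilon$ with $c(\epsilon)=1/\int\psi\hat\Phi_\epsilon$. The approximate mean curvature of $V$ is $$h_\epsilon(x,V)=\int_{\mathbb R^n}\Phi_\epsilon(x-y)\,\tilde h_\epsilon(y,V)\,dy,\qquad \tilde h_\epsilon(y,V)=-\frac{\int S(\nabla\Phi_\epsilon(z-y))\,dV(z,S)}{\int\Phi_\epsilon(z-y)\,d\|V\|(z)+\epsilon}.$$ Given a varifold $V_0$ of finite mass and compact support and $j\in\mathbb N$, the time-discrete approximate mean curvature flow $V_{\epsilon,j}$ for the dyadic subdivision $t_i=i2^{-j}$ of $[0,1]$ is defined (for all large $j$, when the maps below are diffeomorphisms) by $V_{\epsilon,j}(0)=V_0$ and $$V_{\epsilon,j}(t)=\big[\mathrm{id}+(t-t_i)\,h_\epsilon(\cdot,V_{\epsilon,j}(t_i))\big]_\#V_{\epsilon,j}(t_i),\qquad t\in[t_i,t_{i+1}].$$ The approximate mean curvature flow starting from $V_0$ is the family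 of varifolds $(V_\epsilon(t))_{t\in[0,1]}$ such that, for every $t\in[0,1]$, $V_\epsilon(t)$ is the weak-$*$ limit of $V_{\epsilon,j}(t)$ as $j\to\infty$. **Proposition.** Let $\epsilon\in(0,1)$ and $M\ge1$, let $V_0$ be a $d$-varifold in $\mathbb R^n$ with compact support and $\|V_0\|(\mathbb R^n)\le M$, and let $(V_\epsilon(t))_{t\in[0,1]}$ be the approximate mean curvature flow starting from $V_0$. Then for every $\phi\in C^1([0,1]\times\mathbb R^n,\mathbb R_+)$ and all $0\le a\le b\le1$, $$\|V_\epsilon(b)\|(\phi(\cdot,b))-\|V_\epsilon(a)\|(\phi(\cdot,a))=\int_a^b\delta\big(V_\epsilon(t),\phi(\cdot,t)\big)\big(h_\epsilon(\cdot,V_\epsilon(t))\big)\,dt+\int_a^b\|V_\epsilon(t)\|\big(\partial_t\phi(\cdot,t)\big)\,dt,$$ where all these integrals, in space and in time, converge absolutely. -/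

import Mathlib

open Set Filter Topology MeasureTheory
open scoped ContDiff RealInnerProductSpace ENNReal

noncomputable section

namespace VarifoldFlow

/-- The Euclidean space `ℝⁿ`. -/
abbrev E (n : ℕ) : Type := EuclideanSpace ℝ (Fin n)

/-- The Grassmannian of `d`-dimensional subspaces of `ℝⁿ`, a subspace being identified with the
orthogonal projection onto it; the distance of `S` and `T` is the operator norm `‖S - T‖`, and the
sigma-algebra is the Borel one. -/
abbrev Gr (d n : ℕ) : Type :=
  {P : E n →L[ℝ] E n // IsStarProjection P ∧ Module.finrank ℝ P.range = d}

/-- The `d`-plane itself, as a linear subspace. -/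
def Gr.plane {d n : ℕ} (S : Gr d n) : Submodule ℝ (E n) := S.1.range

/-- Borel measures on `ℝⁿ × Gr d n`. A `d`-varifold is such a measure that is Radon, which on this
locally compact separable metric space means finite on compact sets. -/
abbrev VMeasure (d n : ℕ) : Type := Measure (E n × Gr d n)

/-- The mass measure `‖V‖`. -/
def mass {d n : ℕ} (V : VMeasure d n) : Measure (E n) := V.map Prod.fst

/-- Weak-* convergence of Radon measures. -/
def WeakStar {d n : ℕ} (V : ℕ → VMeasure d n) (W : VMeasure d n) : Prop :=
  ∀ g : E n × Gr d n → ℝ, Continuous g → HasCompactSupport g → (∀ p, 0 ≤ g p) →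
    Tendsto (fun j => ∫ p, g p ∂(V j)) atTop (𝓝 (∫ p, g p ∂W))

/-! Push-forward of varifolds -/

/-- The image `A(S)` of the `d`-plane `S` by the linear map `A`, when it is again a `d`-plane (in
particular when `A` is invertible); the value `S` in the other case is irrelevant. -/
def imagePlane {d n : ℕ} (A : E n →L[ℝ] E n) (S : Gr d n) : Gr d n := by
  classical
  exact
    if h : Module.finrank ℝ (S.plane.map (A : E n →ₗ[ℝ] E n)) = d then
      ⟨(S.plane.map (A : E n →ₗ[ℝ] E n)).starProjection,
        isStarProjection_starProjection, by rw [Submodule.range_starProjection]; exact h⟩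
    else S

/-- The tangential Jacobian `det (Yᵗ Y) ^ (1/2)`, where `Y` is the restriction of `A` to `S`. -/
def tangentialJacobian {d n : ℕ} (A : E n →L[ℝ] E n) (S : Gr d n) : ℝ :=
  let Y : S.plane →ₗ[ℝ] E n := (A : E n →ₗ[ℝ] E n) ∘ₗ S.plane.subtype
  Real.sqrt (LinearMap.det (LinearMap.adjoint Y ∘ₗ Y))

/-- The push-forward varifold `f_# V`, that is
`f_# V (g) = ∫ g (f x, Df(x)(S)) J_S f(x) dV(x, S)`. -/
def pushForward {d n : ℕ} (f : E n → E n) (V : VMeasure d n) : VMeasure d n :=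
  (V.withDensity fun p => ENNReal.ofReal (tangentialJacobian (fderiv ℝ f p.1) p.2)).map
    fun p => (f p.1, imagePlane (fderiv ℝ f p.1) p.2)

/-! First variation -/

/-- The tangential divergence `div_S X (x) = tr (S ∘ DX(x))`. -/
def tangentialDiv {d n : ℕ} (X : E n → E n) (x : E n) (S : Gr d n) : ℝ :=
  LinearMap.trace ℝ (E n) ((S.1 ∘L fderiv ℝ X x : E n →L[ℝ] E n) : E n →ₗ[ℝ] E n)

/-- The weighted first variation `δ(V, φ)(X)`. -/
def weightedFirstVariation {d n : ℕ} (V : VMeasure d n) (φ : E n → ℝ) (X : E n → E n) : ℝ :=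
  (∫ p, φ p.1 * tangentialDiv X p.1 p.2 ∂V) + ∫ p, ⟪gradient φ p.1, X p.1⟫ ∂V

/-! Regularization kernel and approximate mean curvature -/

/-- Smooth radially symmetric cut-off functions, equal to `1` on the ball of radius `1/2` and to
`0` off the unit ball. -/
structure IsCutoff {n : ℕ} (ψ : E n → ℝ) : Prop where
  smooth : ContDiff ℝ ∞ ψ
  radial : ∀ x y, ‖x‖ = ‖y‖ → ψ x = ψ y
  eq_one : ∀ x, ‖x‖ ≤ 1 / 2 → ψ x = 1
  eq_zero : ∀ x, 1 ≤ ‖x‖ → ψ x = 0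
  nonneg : ∀ x, 0 ≤ ψ x
  le_one : ∀ x, ψ x ≤ 1

/-- The Gaussian kernel of variance `ε²`. -/
def gaussianKernel {n : ℕ} (ε : ℝ) (x : E n) : ℝ :=
  1 / (2 * Real.pi * ε ^ 2) ^ ((n : ℝ) / 2) * Real.exp (-‖x‖ ^ 2 / (2 * ε ^ 2))

/-- The kernel `Φ_ε = c(ε) ψ Φ̂_ε` of integral `1`, with `c(ε) = 1 / ∫ ψ Φ̂_ε`. -/
def kernel {n : ℕ} (ψ : E n → ℝ) (ε : ℝ) (x : E n) : ℝ :=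
  (1 / ∫ y, ψ y * gaussianKernel ε y) * ψ x * gaussianKernel ε x

/-- `(‖V‖ * Φ_ε)(y)`. -/
def massConv {d n : ℕ} (ψ : E n → ℝ) (ε : ℝ) (V : VMeasure d n) (y : E n) : ℝ :=
  ∫ z, kernel ψ ε (z - y) ∂(mass V)

/-- `(δV * Φ_ε)(y) = ∫ S (∇Φ_ε (z - y)) dV(z, S)`. -/
def firstVariationConv {d n : ℕ} (ψ : E n → ℝ) (ε : ℝ) (V : VMeasure d n) (y : E n) : E n :=
  ∫ p, p.2.1 (gradient (kernel ψ ε) (p.1 - y)) ∂V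

/-- `h̃_ε(y, V) = - (δV * Φ_ε)(y) / ((‖V‖ * Φ_ε)(y) + ε)`. -/
def preCurvature {d n : ℕ} (ψ : E n → ℝ) (ε : ℝ) (V : VMeasure d n) (y : E n) : E n :=
  -((massConv ψ ε V y + ε)⁻¹ • firstVariationConv ψ ε V y)

/-- The approximate mean curvature `h_ε(x, V) = (Φ_ε * h̃_ε(·, V))(x)`. -/
def approxCurvature {d n : ℕ} (ψ : E n → ℝ) (ε : ℝ) (V : VMeasure d n) (x : E n) : E n :=
  ∫ y, kernel ψ ε (x - y) • preCurvature ψ ε V y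

/-! Approximate mean curvature flow -/

/-- One step of length `τ`: the push-forward of `V` by `id + τ h_ε(·, V)`. -/
def step {d n : ℕ} (ψ : E n → ℝ) (ε τ : ℝ) (V : VMeasure d n) : VMeasure d n :=
  pushForward (fun x => x + τ • approxCurvature ψ ε V x) V

/-- The time-discrete approximate mean curvature flow at the nodes `0 = s 0 < s 1 < ⋯`. -/
def nodeFlow {d n : ℕ} (ψ : E n → ℝ) (ε : ℝ) (V₀ : VMeasure d n) (s : ℕ → ℝ) : ℕ → VMeasure d n
  | 0 => V₀
  | i + 1 => step ψ ε (s (i + 1) - s i) (nodeFlow ψ ε V₀ s i)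

/-- The time-discrete approximate mean curvature flow for the subdivision of `[0, 1]` into the
points `k / 2 ^ j`, at an arbitrary time `t ∈ [0, 1]`: if `i` is the index with
`i / 2 ^ j ≤ t < (i + 1) / 2 ^ j`, then the varifold at the node `i / 2 ^ j` makes a step of length
`t - i / 2 ^ j`. -/
def dyadicFlow {d n : ℕ} (ψ : E n → ℝ) (ε : ℝ) (V₀ : VMeasure d n) (j : ℕ) (t : ℝ) :
    VMeasure d n :=
  let s : ℕ → ℝ := fun k => (k : ℝ) / 2 ^ j
  let i : ℕ := ⌊t * 2 ^ j⌋₊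
  step ψ ε (t - s i) (nodeFlow ψ ε V₀ s i)

/-- `V` is, on `[0, 1]`, the approximate mean curvature flow starting from `V₀`: for every
`t ∈ [0, 1]`, `V t` is the varifold that is the weak-* limit, as `j → ∞`, of the time-discrete
flows for the dyadic subdivisions. -/
def IsApproxMCF {d n : ℕ} (ψ : E n → ℝ) (ε : ℝ) (V₀ : VMeasure d n) (V : ℝ → VMeasure d n) :
    Prop :=
  ∀ t ∈ Icc (0 : ℝ) 1, IsFiniteMeasureOnCompacts (V t) ∧
    WeakStar (fun j => dyadicFlow ψ ε V₀ j t) (V t)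

end VarifoldFlow

end

open VarifoldFlow

namespace VarifoldFlow

variable {d n : ℕ}

/-! ### The Grassmannian -/

/-! The equality is the limit of a discrete one. Pushing `V` forward by `id + τ X` changes the
integral of a test function by `τ (δ(V, φ)(X) + ∫ ∂ₜφ d‖V‖)` up to `o(τ)`, because the tangential
Jacobian is `1 + τ div_S X + o(τ)`. The error is uniform over all varifolds with a given mass bound
in a given ball and all fields with a given `C¹` bound (`IsTest.exists_pushForward_expansion`).
Summed over the at most `2 ^ j` steps, the errors `η τ` total at most `η`, so along the discrete
flow the identity holds up to any `η` once `j` is large (`IsTest.eventually_abs_dyadicFlow_sub_le`).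

Uniformity needs a priori bounds (`exists_flow_bound`). The `C¹` norm of `h_ε` is at most a constant
times the mass. By Fubini, `δV(h_ε)` is minus the integral of `|δV * Φ_ε|² / (‖V‖ * Φ_ε + ε)`, hence
nonpositive (`SuppIn.firstVariation_nonpos`). So the mass grows only through the `o(τ)` errors and
stays below `M + 1`, and the support stays in a fixed ball.

In the limit `j → ∞`, the uniform support bound upgrades weak-* convergence to convergence against
all continuous functions (`WeakStar.weakConv`), and the node preceding `t` has the same limit as the
flow at `t`. The rate `δ(V, φ)(h_ε(·, V))` is nonlinear in `V`, but Fubini writes it as an integral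
over `y` of the product of two factors, each converging for fixed `y`. Dominated convergence in `y`
gives convergence of the rates (`IsTest.tendsto_weightedFirstVariation`), and dominated convergence
in `t` gives convergence of the time integrals. Measurability in time is inherited from step
functions, so no continuity of `t ↦ V t` is needed. -/

lemma Gr.eq_starProjection (S : Gr d n) : S.1 = S.plane.starProjection := by
  obtain ⟨_, h⟩ := isStarProjection_iff_eq_starProjection_range.1 S.2.1
  exact h

lemma Gr.norm_le_one (S : Gr d n) : ‖S.1‖ ≤ 1 := by
  rw [S.eq_starProjection]
  exact S.plane.starProjection_norm_le

lemma Gr.norm_apply_le (S : Gr d n) (u : E n) : ‖S.1 u‖ ≤ ‖u‖ := by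
  simpa using (S.1.le_opNorm u).trans (mul_le_mul_of_nonneg_right S.norm_le_one (norm_nonneg u))

lemma Gr.inner_apply_left (S : Gr d n) (u v : E n) : ⟪S.1 u, v⟫ = ⟪u, S.1 v⟫ := by
  rw [S.eq_starProjection]
  exact S.plane.inner_starProjection_left_eq_right u v

lemma Gr.apply_of_mem (S : Gr d n) {u : E n} (hu : u ∈ S.plane) : S.1 u = u := by
  rw [S.eq_starProjection]
  exact Submodule.starProjection_eq_self_iff.2 hu

lemma Gr.apply_mem (S : Gr d n) (u : E n) : S.1 u ∈ S.plane := ⟨u, rfl⟩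

/-- The trace as a continuous linear functional. -/
noncomputable def traceCLM (n : ℕ) : (E n →L[ℝ] E n) →L[ℝ] ℝ :=
  LinearMap.toContinuousLinearMap
    (LinearMap.trace ℝ (E n) ∘ₗ (ContinuousLinearMap.coeLM ℝ))

lemma traceCLM_apply (A : E n →L[ℝ] E n) :
    traceCLM n A = LinearMap.trace ℝ (E n) (A : E n →ₗ[ℝ] E n) := rfl

lemma traceCLM_of_isStarProjection {P : E n →L[ℝ] E n} (hP : IsStarProjection P) :
    traceCLM n P = Module.finrank ℝ P.range := by
  rw [traceCLM_apply]
  have h : IsIdempotentElem (P : E n →ₗ[ℝ] E n) := by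
    have := hP.isIdempotentElem
    unfold IsIdempotentElem at this ⊢
    exact congrArg (fun A : E n →L[ℝ] E n => (A : E n →ₗ[ℝ] E n)) this
  exact LinearMap.IsProj.trace (LinearMap.IsIdempotentElem.isProj_range _ h)

lemma continuous_star_clm : Continuous fun A : E n →L[ℝ] E n => star A :=
  (ContinuousLinearMap.adjoint (𝕜 := ℝ) (E := E n) (F := E n)).continuous

lemma norm_star_clm (A : E n →L[ℝ] E n) : ‖star A‖ = ‖A‖ := norm_star A

lemma star_one_add_clm (A : E n →L[ℝ] E n) : star (1 + A) = 1 + star A :=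
  (star_add 1 A).trans (by rw [star_one])

/-- Rank is not a continuous function of the operator, but for an orthogonal projection it equals
the trace. The Grassmannian is thus cut out of the unit ball of operators by closed conditions. Its
compactness makes the sets over closed balls of `ℝⁿ` compact, on which all later uniformity rests.
-/
instance compactSpace_Gr : CompactSpace (Gr d n) := by
  have hset : {P : E n →L[ℝ] E n | IsStarProjection P ∧ Module.finrank ℝ P.range = d} =
      {P : E n →L[ℝ] E n | P * P = P ∧ star P = P ∧ traceCLM n P = d} := by
    ext P
    constructor
    · rintro ⟨h, h'⟩
      exact ⟨h.isIdempotentElem, h.isSelfAdjoint, by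
        rw [traceCLM_of_isStarProjection h, h']⟩
    · rintro ⟨h1, h2, h3⟩
      have h : IsStarProjection P := ⟨h1, h2⟩
      refine ⟨h, ?_⟩
      rw [traceCLM_of_isStarProjection h] at h3
      exact_mod_cast h3
  have hclosed : IsClosed
      {P : E n →L[ℝ] E n | IsStarProjection P ∧ Module.finrank ℝ P.range = d} := by
    rw [hset]
    refine (isClosed_eq (by fun_prop) (by fun_prop)).inter
      ((isClosed_eq continuous_star_clm continuous_id).inter (isClosed_eq (by fun_prop) (by fun_prop)))
  refine isCompact_iff_compactSpace.1 ?_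
  refine Metric.isCompact_of_isClosed_isBounded hclosed ?_
  refine (Metric.isBounded_closedBall (x := (0 : E n →L[ℝ] E n)) (r := 1)).subset ?_
  intro P hP
  simpa using Gr.norm_le_one (⟨P, hP⟩ : Gr d n)

/-- With `P`, `P'` the two projections, `P - P' = (1 - P') P - P' (1 - P)`. The first term measures
how far `T` is from `T'`; the second is the adjoint of the same expression with the roles exchanged.
-/
lemma norm_starProjection_sub_le {T T' : Submodule ℝ (E n)} {η : ℝ}
    (h : ∀ u ∈ T, ∃ v ∈ T', ‖u - v‖ ≤ η * ‖u‖) (h' : ∀ u ∈ T', ∃ v ∈ T, ‖u - v‖ ≤ η * ‖u‖)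
    (hη : 0 ≤ η) : ‖T.starProjection - T'.starProjection‖ ≤ 2 * η := by
  have key : ∀ T T' : Submodule ℝ (E n), (∀ u ∈ T, ∃ v ∈ T', ‖u - v‖ ≤ η * ‖u‖) →
      ‖(1 - T'.starProjection) * T.starProjection‖ ≤ η := by
    intro T T' h
    refine ContinuousLinearMap.opNorm_le_bound _ hη fun x => ?_
    obtain ⟨v, hv, hvle⟩ := h (T.starProjection x) (T.starProjection_apply_mem x)
    have h1 : ‖T.starProjection x - T'.starProjection (T.starProjection x)‖
        ≤ ‖T.starProjection x - v‖ := by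
      rw [Submodule.starProjection_minimal]
      exact ciInf_le ⟨0, by rintro _ ⟨w, rfl⟩; exact norm_nonneg _⟩ (⟨v, hv⟩ : T')
    calc ‖((1 - T'.starProjection) * T.starProjection) x‖
        = ‖T.starProjection x - T'.starProjection (T.starProjection x)‖ := by simp
      _ ≤ η * ‖T.starProjection x‖ := h1.trans hvle
      _ ≤ η * ‖x‖ := by gcongr; exact T.norm_starProjection_apply_le x
  have h2 : ‖T'.starProjection * (1 - T.starProjection)‖ ≤ η := by
    rw [← norm_star]
    have hs : ∀ U : Submodule ℝ (E n), star U.starProjection = U.starProjection :=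
      fun U => isSelfAdjoint_starProjection U
    rw [star_mul, star_sub, hs, hs, star_one]
    exact key T' T h'
  have : T.starProjection - T'.starProjection =
      (1 - T'.starProjection) * T.starProjection - T'.starProjection * (1 - T.starProjection) := by
    noncomm_ring
  rw [this]
  calc _ ≤ _ := norm_sub_le _ _
    _ ≤ 2 * η := by linarith [key T T' h]

lemma finrank_map_plane {A : E n →L[ℝ] E n} (hA : ∀ u, ‖u‖ ≤ 2 * ‖A u‖) (S : Gr d n) :
    Module.finrank ℝ (S.plane.map (A : E n →ₗ[ℝ] E n)) = d := by
  have hinj : Function.Injective (A : E n →ₗ[ℝ] E n) := by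
    rw [injective_iff_map_eq_zero]
    intro u hu
    have := hA u
    have hu' : A u = 0 := hu
    rw [hu'] at this
    simpa using this
  rw [← (Submodule.equivMapOfInjective (A : E n →ₗ[ℝ] E n) hinj S.plane).finrank_eq]
  exact S.2.2

lemma imagePlane_coe {A : E n →L[ℝ] E n} (hA : ∀ u, ‖u‖ ≤ 2 * ‖A u‖) (S : Gr d n) :
    (imagePlane A S).1 = (S.plane.map (A : E n →ₗ[ℝ] E n)).starProjection := by
  unfold imagePlane
  rw [dif_pos (finrank_map_plane hA S)]

/-- A vector `A w` with `w ∈ S` is compared with `A' (S' w)`, which lies in the other image. The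
lower bound `‖w‖ ≤ 2 ‖A w‖` turns the error into a relative one, and the gap estimate then doubles
the constants `2` and `4`. -/
lemma dist_imagePlane_le {A A' : E n →L[ℝ] E n} (hA : ∀ u, ‖u‖ ≤ 2 * ‖A u‖)
    (hA' : ∀ u, ‖u‖ ≤ 2 * ‖A' u‖) (hn : ‖A‖ ≤ 2) (hn' : ‖A'‖ ≤ 2) (S S' : Gr d n) :
    dist (imagePlane A S) (imagePlane A' S') ≤ 4 * dist A A' + 8 * dist S S' := by
  have key : ∀ (A A' : E n →L[ℝ] E n) (S S' : Gr d n), (∀ u, ‖u‖ ≤ 2 * ‖A u‖) → ‖A'‖ ≤ 2 →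
      ∀ u ∈ S.plane.map (A : E n →ₗ[ℝ] E n), ∃ v ∈ S'.plane.map (A' : E n →ₗ[ℝ] E n),
      ‖u - v‖ ≤ (2 * dist A A' + 4 * dist S S') * ‖u‖ := by
    rintro A A' S S' hA hA' _ ⟨w, hw, rfl⟩
    refine ⟨A' (S'.1 w), ⟨_, S'.apply_mem w, rfl⟩, ?_⟩
    have h1 : A w - A' (S'.1 w) = (A - A') w + A' ((S.1 - S'.1) w) := by
      simp [S.apply_of_mem hw]
    have h2 : ‖A w - A' (S'.1 w)‖ ≤ dist A A' * ‖w‖ + 2 * (dist S S' * ‖w‖) := by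
      rw [h1]
      refine (norm_add_le _ _).trans (add_le_add ?_ ?_)
      · rw [dist_eq_norm]; exact (A - A').le_opNorm w
      · refine (A'.le_opNorm _).trans ?_
        gcongr
        rw [Subtype.dist_eq, dist_eq_norm]
        exact (S.1 - S'.1).le_opNorm w
    refine h2.trans ?_
    have := hA w
    calc dist A A' * ‖w‖ + 2 * (dist S S' * ‖w‖) = (dist A A' + 2 * dist S S') * ‖w‖ := by ring
      _ ≤ (dist A A' + 2 * dist S S') * (2 * ‖A w‖) := by gcongr
      _ = _ := by simp only [ContinuousLinearMap.coe_coe]; ring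
  rw [Subtype.dist_eq, imagePlane_coe hA, imagePlane_coe hA', dist_eq_norm]
  refine (norm_starProjection_sub_le (key A A' S S' hA hn') ?_ (by positivity)).trans
    (le_of_eq (by ring : _ = 4 * dist A A' + 8 * dist S S'))
  intro u hu
  rw [dist_comm A, dist_comm S]
  exact key A' A S' S hA' hn u hu

lemma imagePlane_one (S : Gr d n) : imagePlane (1 : E n →L[ℝ] E n) S = S := by
  apply Subtype.ext
  rw [imagePlane_coe (by intro u; simp only [one_apply_eq_self];
                         linarith [norm_nonneg u]), S.eq_starProjection]
  congr
  exact Submodule.map_id _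

lemma one_add_mul_one_add_sub_one_mul {R : Type*} [Ring R] (a b s : R) :
    ((1 + b) * (1 + a) - 1) * s = a * s + b * s + b * a * s := by
  noncomm_ring

/-! ### The tangential Jacobian -/

lemma det_one_add_comp_comm {M N : Type*} [AddCommGroup M] [Module ℝ M] [AddCommGroup N]
    [Module ℝ N] [FiniteDimensional ℝ M] [FiniteDimensional ℝ N] (f : M →ₗ[ℝ] N)
    (g : N →ₗ[ℝ] M) : LinearMap.det (1 + f ∘ₗ g) = LinearMap.det (1 + g ∘ₗ f) := by
  classical
  let b := Module.finBasis ℝ M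
  let c := Module.finBasis ℝ N
  rw [← LinearMap.det_toMatrix c, ← LinearMap.det_toMatrix b, map_add, map_add,
    LinearMap.toMatrix_comp c b c, LinearMap.toMatrix_comp b c b, LinearMap.toMatrix_one,
    LinearMap.toMatrix_one, Matrix.det_one_add_mul_comm]

/-- On `S` one has `YᵗY = 1 + π (AᵗA - 1) ι`, with `ι` the inclusion and `π` the projection onto
`S`. Sylvester's identity `det (1 + f g) = det (1 + g f)` moves the determinant to the fixed space
`ℝⁿ`, where continuity and differentiation no longer involve a varying domain. -/
lemma tangentialJacobian_eq (A : E n →L[ℝ] E n) (S : Gr d n) :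
    tangentialJacobian A S =
      Real.sqrt ((1 + (star A * A - 1) * S.1 : E n →L[ℝ] E n).det) := by
  unfold tangentialJacobian
  simp only
  congr 1
  let ι : S.plane →ₗ[ℝ] E n := S.plane.subtype
  let π : E n →ₗ[ℝ] S.plane := (S.1 : E n →ₗ[ℝ] E n).codRestrict S.plane S.apply_mem
  let D : E n →ₗ[ℝ] E n := ((star A * A - 1 : E n →L[ℝ] E n) : E n →ₗ[ℝ] E n)
  set Y : S.plane →ₗ[ℝ] E n := (A : E n →ₗ[ℝ] E n) ∘ₗ S.plane.subtype with hY
  have h1 : LinearMap.adjoint Y ∘ₗ Y = 1 + π ∘ₗ (D ∘ₗ ι) := by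
    ext1 u
    refine ext_inner_right ℝ fun v => ?_
    have hv : S.1 (v : E n) = v := S.apply_of_mem v.2
    simp only [LinearMap.comp_apply, LinearMap.adjoint_inner_left, LinearMap.add_apply,
      inner_add_left]
    have e1 : ⟪π (D (ι u)), v⟫ = ⟪S.1 (D (ι u)), (v : E n)⟫ := rfl
    have e2 : D (ι u) = star A (A u) - u := by simp [D, ι]
    rw [e1, S.inner_apply_left, hv, e2, inner_sub_left, ContinuousLinearMap.star_eq_adjoint,
      ContinuousLinearMap.adjoint_inner_left]
    simp [hY]
  rw [h1, det_one_add_comp_comm]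
  rfl

lemma contDiff_det : ContDiff ℝ 1 (fun A : E n →L[ℝ] E n => A.det) := by
  let b := (Module.finBasis ℝ (E n))
  have h : (fun A : E n →L[ℝ] E n => A.det) =
      fun A : E n →L[ℝ] E n => (LinearMap.toMatrix b b (A : E n →ₗ[ℝ] E n)).det := by
    funext A
    rw [LinearMap.det_toMatrix]
  rw [h]
  simp only [Matrix.det_apply]
  refine ContDiff.sum fun σ _ => ContDiff.const_smul _ (contDiff_prod fun i _ => ?_)
  let L : (E n →L[ℝ] E n) →ₗ[ℝ] ℝ :=
    (Matrix.entryLinearMap ℝ ℝ (σ i) i) ∘ₗ (LinearMap.toMatrix b b).toLinearMap ∘ₗ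
      ContinuousLinearMap.coeLM ℝ
  exact (LinearMap.toContinuousLinearMap L).contDiff

/-- The determinant being differentiable, its derivative is determined along lines, where `det (1 +
r B)` is a polynomial in `r` with linear coefficient `tr B`. -/
lemma hasFDerivAt_det_one :
    HasFDerivAt (fun A : E n →L[ℝ] E n => A.det) (traceCLM n) 1 := by
  have hd : DifferentiableAt ℝ (fun A : E n →L[ℝ] E n => A.det) 1 :=
    contDiff_det.differentiable (by norm_num) 1
  have h := hd.hasFDerivAt
  convert h using 1
  refine ContinuousLinearMap.ext fun B => ?_
  have hline : HasDerivAt (fun r : ℝ => (1 + r • B : E n →L[ℝ] E n)) B 0 := by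
    simpa using ((hasDerivAt_id (0 : ℝ)).smul_const B).const_add (1 : E n →L[ℝ] E n)
  have h1 : HasDerivAt (fun r : ℝ => (1 + r • B : E n →L[ℝ] E n).det)
      (fderiv ℝ (fun A : E n →L[ℝ] E n => A.det) 1 B) 0 := by
    have : HasFDerivAt (fun A : E n →L[ℝ] E n => A.det)
      (fderiv ℝ (fun A : E n →L[ℝ] E n => A.det) 1) ((1 + (0 : ℝ) • B : E n →L[ℝ] E n)) := by
      rwa [show (1 + (0 : ℝ) • B : E n →L[ℝ] E n) = 1 from by ext1 u; simp]
    exact this.comp_hasDerivAt (0 : ℝ) hline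
  let b := (Module.finBasis ℝ (E n))
  let m := LinearMap.toMatrix b b (B : E n →ₗ[ℝ] E n)
  let p := (1 + (Polynomial.X : Polynomial ℝ) • m.map Polynomial.C).det.divX.divX
  have h2 : (fun r : ℝ => (1 + r • B : E n →L[ℝ] E n).det) =
      fun r => 1 + m.trace * r + p.eval r * r ^ 2 := by
    funext r
    rw [← Matrix.det_one_add_smul]
    change LinearMap.det (1 + r • (B : E n →ₗ[ℝ] E n)) = _
    rw [← LinearMap.det_toMatrix b, map_add, map_smul, LinearMap.toMatrix_one]
  have h3 : HasDerivAt (fun r : ℝ => 1 + m.trace * r + p.eval r * r ^ 2) m.trace 0 := by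
    have e1 := ((hasDerivAt_id (0 : ℝ)).const_mul m.trace).const_add 1
    have e2 := (p.hasDerivAt 0).mul ((hasDerivAt_id (0 : ℝ)).pow 2)
    exact (e1.add e2).congr_deriv (by simp)
  rw [h2] at h1
  rw [h1.unique h3, traceCLM_apply, LinearMap.trace_eq_matrix_trace ℝ b]

lemma hasFDerivAt_sqrt_det :
    HasFDerivAt (fun X : E n →L[ℝ] E n => Real.sqrt (1 + X).det) ((1 / 2 : ℝ) • traceCLM n) 0 := by
  have h0 : HasFDerivAt (fun X : E n →L[ℝ] E n => (1 + X).det) (traceCLM n) 0 := by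
    have h1 : HasFDerivAt (fun A : E n →L[ℝ] E n => A.det) (traceCLM n)
        ((1 : E n →L[ℝ] E n) + 0) := by
      simpa using hasFDerivAt_det_one
    have h2 : HasFDerivAt (fun X : E n →L[ℝ] E n => 1 + X) (ContinuousLinearMap.id ℝ _) 0 :=
      (hasFDerivAt_id _).const_add _
    exact h1.comp (0 : E n →L[ℝ] E n) h2
  have hdet : ((1 : E n →L[ℝ] E n) + 0).det = 1 := by simp [ContinuousLinearMap.det]
  have := h0.sqrt (by rw [hdet]; norm_num)
  rw [hdet] at this
  simpa using this

/-- First-order expansion of the tangential Jacobian at the identity, uniform in the plane. -/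
lemma exists_tangentialJacobian_expansion (n : ℕ) {δ : ℝ} (hδ : 0 < δ) :
    ∃ r > 0, ∀ (d : ℕ) (L : E n →L[ℝ] E n) (S : Gr d n), ‖L‖ ≤ r →
      |tangentialJacobian (1 + L) S - 1 - traceCLM n (S.1 * L)| ≤ δ * ‖L‖ := by
  have h := (hasFDerivAt_sqrt_det (n := n)).isLittleO.def (c := δ / 6) (by positivity)
  obtain ⟨r₁, hr₁, hball⟩ := Metric.eventually_nhds_iff_ball.1 h
  set T := ‖traceCLM n‖ with hT
  -- Below, `‖L‖ ≤ 1` gives `‖X‖ ≤ 3 ‖L‖`, so `r₁ / 4` keeps `X` in the ball of radius `r₁` and the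
  -- remainder costs `δ/6 · 3 ‖L‖`. The bound `δ / (T + 1)` makes the quadratic term cost the
  -- remaining `δ/2 · ‖L‖`.
  refine ⟨min 1 (min (r₁ / 4) (δ / (T + 1))), by positivity, fun d L S hL => ?_⟩
  have hL1 : ‖L‖ ≤ 1 := hL.trans (min_le_left _ _)
  have hL2 : ‖L‖ ≤ r₁ / 4 := hL.trans ((min_le_right _ _).trans (min_le_left _ _))
  have hL3 : ‖L‖ ≤ δ / (T + 1) := hL.trans ((min_le_right _ _).trans (min_le_right _ _))
  set X : E n →L[ℝ] E n := (star (1 + L) * (1 + L) - 1) * S.1 with hX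
  have hXe : X = L * S.1 + star L * S.1 + star L * L * S.1 := by
    rw [hX, star_one_add_clm]
    exact one_add_mul_one_add_sub_one_mul L (star L) S.1
  have hmul : ∀ B : E n →L[ℝ] E n, ‖B * S.1‖ ≤ ‖B‖ := fun B =>
    (norm_mul_le _ _).trans (by
      simpa using mul_le_mul_of_nonneg_left S.norm_le_one (norm_nonneg B))
  have hLL : ‖star L * L‖ ≤ ‖L‖ * ‖L‖ := (norm_mul_le _ _).trans (by rw [norm_star_clm])
  have hX3 : ‖X‖ ≤ 3 * ‖L‖ := by
    rw [hXe]
    have e1 := hmul L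
    have e2 := hmul (star L)
    have e3 := (hmul (star L * L)).trans hLL
    rw [norm_star_clm] at e2
    have e4 : ‖L‖ * ‖L‖ ≤ 1 * ‖L‖ := by gcongr
    calc _ ≤ ‖L * S.1‖ + ‖star L * S.1‖ + ‖star L * L * S.1‖ := norm_add₃_le
      _ ≤ 3 * ‖L‖ := by linarith
  have hb := hball X (by
    rw [mem_ball_zero_iff]
    linarith)
  have htr1 : traceCLM n (L * S.1) = traceCLM n (S.1 * L) := by
    simp only [traceCLM_apply]
    exact LinearMap.trace_mul_comm ℝ (L : E n →ₗ[ℝ] E n) (S.1 : E n →ₗ[ℝ] E n)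
  have htr2 : traceCLM n (star L * S.1) = traceCLM n (S.1 * L) := by
    have hs : star L * S.1 = star (S.1 * L) := by
      rw [star_mul, S.2.1.isSelfAdjoint.star_eq]
    rw [hs]
    simp only [traceCLM_apply]
    let b := stdOrthonormalBasis ℝ (E n)
    rw [LinearMap.trace_eq_sum_inner _ b, LinearMap.trace_eq_sum_inner _ b]
    refine Finset.sum_congr rfl fun i _ => ?_
    simp only [ContinuousLinearMap.coe_coe, ContinuousLinearMap.star_eq_adjoint]
    rw [ContinuousLinearMap.adjoint_inner_right, real_inner_comm]
  -- The two linear terms of `X` have the same trace, which absorbs the factor `1/2` from the square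
  -- root.
  have htr : (1 / 2 : ℝ) * traceCLM n X =
      traceCLM n (S.1 * L) + 1 / 2 * traceCLM n (star L * L * S.1) := by
    rw [hXe, map_add, map_add, htr1, htr2]; ring
  have hq : |traceCLM n (star L * L * S.1)| ≤ δ * ‖L‖ := by
    calc |traceCLM n (star L * L * S.1)| ≤ T * ‖star L * L * S.1‖ := (traceCLM n).le_opNorm _
      _ ≤ (T + 1) * (‖L‖ * ‖L‖) := by
          gcongr
          · linarith
          · exact (hmul _).trans hLL
      _ ≤ (T + 1) * (δ / (T + 1) * ‖L‖) := by gcongr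
      _ = δ * ‖L‖ := by
          have : 0 < T + 1 := by positivity
          field_simp
  have hdet0 : ((1 : E n →L[ℝ] E n) + 0).det = 1 := by simp [ContinuousLinearMap.det]
  rw [tangentialJacobian_eq]
  simp only [hdet0, Real.sqrt_one, sub_zero, smul_apply, smul_eq_mul,
    Real.norm_eq_abs, htr] at hb
  have hb' : |√(1 + X).det - 1 - (traceCLM n (S.1 * L) +
      1 / 2 * traceCLM n (star L * L * S.1))| ≤ δ / 2 * ‖L‖ := by
    refine hb.trans ?_
    calc δ / 6 * ‖X‖ ≤ δ / 6 * (3 * ‖L‖) := by gcongr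
      _ = _ := by ring
  rw [abs_le] at hb' hq ⊢
  constructor <;> linarith [hb'.1, hb'.2, hq.1, hq.2]

lemma continuous_tangentialJacobian :
    Continuous fun q : (E n →L[ℝ] E n) × Gr d n => tangentialJacobian q.1 q.2 := by
  simp only [tangentialJacobian_eq]
  have h := continuous_star_clm (n := n)
  refine Real.continuous_sqrt.comp ((contDiff_det (n := n)).continuous.comp ?_)
  exact continuous_const.add ((((h.comp continuous_fst).mul continuous_fst).sub
    continuous_const).mul (continuous_subtype_val.comp continuous_snd))

lemma tangentialJacobian_nonneg (A : E n →L[ℝ] E n) (S : Gr d n) : 0 ≤ tangentialJacobian A S :=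
  Real.sqrt_nonneg _

lemma tangentialDiv_eq (X : E n → E n) (x : E n) (S : Gr d n) :
    tangentialDiv X x S = traceCLM n (S.1 * fderiv ℝ X x) := rfl

/-! ### Varifolds supported in a ball -/

/-- The mass measure of `V` is carried by the closed ball of radius `R` about the origin. -/
def SuppIn (V : VMeasure d n) (R : ℝ) : Prop := ∀ᵐ p ∂V, ‖p.1‖ ≤ R

lemma SuppIn.mono {V : VMeasure d n} {R R' : ℝ} (h : SuppIn V R) (hR : R ≤ R') : SuppIn V R' :=
  Filter.Eventually.mono h fun _ hp => hp.trans hR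

/-- The compact set of planes based at the points of a closed ball. -/
def cylinder (d n : ℕ) (R : ℝ) : Set (E n × Gr d n) := Metric.closedBall 0 R ×ˢ univ

lemma mem_cylinder {R : ℝ} {p : E n × Gr d n} : p ∈ cylinder d n R ↔ ‖p.1‖ ≤ R := by
  simp [cylinder]

lemma isCompact_cylinder (R : ℝ) : IsCompact (cylinder d n R) :=
  (isCompact_closedBall 0 R).prod isCompact_univ

lemma SuppIn.integrable {F : Type*} [NormedAddCommGroup F] {V : VMeasure d n}
    [IsFiniteMeasureOnCompacts V] {R : ℝ} (h : SuppIn V R) {g : E n × Gr d n → F}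
    (hg : Continuous g) : Integrable g V := by
  have h1 : IntegrableOn g (cylinder d n R) V :=
    hg.continuousOn.integrableOn_compact (isCompact_cylinder R)
  have h2 : V.restrict (cylinder d n R) = V :=
    Measure.restrict_eq_self_of_ae_mem (Filter.Eventually.mono h fun p hp => mem_cylinder.2 hp)
  rwa [IntegrableOn, h2] at h1

lemma integral_mass {F : Type*} [NormedAddCommGroup F] [NormedSpace ℝ F]
    [SecondCountableTopology F] {V : VMeasure d n} {g : E n → F}
    (hg : Continuous g) : ∫ x, g x ∂(mass V) = ∫ p, g p.1 ∂V :=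
  integral_map measurable_fst.aemeasurable hg.aestronglyMeasurable

lemma SuppIn.integrable_mass {F : Type*} [NormedAddCommGroup F]
    [SecondCountableTopology F] {V : VMeasure d n}
    [IsFiniteMeasureOnCompacts V] {R : ℝ} (h : SuppIn V R) {g : E n → F}
    (hg : Continuous g) : Integrable g (mass V) :=
  (integrable_map_measure hg.aestronglyMeasurable measurable_fst.aemeasurable).2
    (h.integrable (hg.comp continuous_fst))

/-- The kernel has range `1`, so for base points in the ball of radius `R` only `y` in the ball of
radius `R + 1` contribute, and the integrand lives on a compact set. -/
lemma SuppIn.integrable_prod {V : VMeasure d n} [IsFiniteMeasure V] {R : ℝ} (h : SuppIn V R)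
    {w : (E n × Gr d n) × E n → ℝ} (hw : Continuous w)
    (h0 : ∀ p y, 1 < ‖p.1 - y‖ → w (p, y) = 0) : Integrable w (V.prod volume) := by
  have hK : IsCompact (cylinder d n R ×ˢ Metric.closedBall (0 : E n) (R + 1)) :=
    (isCompact_cylinder R).prod (isCompact_closedBall _ _)
  refine (hw.continuousOn.integrableOn_compact hK).integrable_of_ae_notMem_eq_zero ?_
  have h' : ∀ᵐ q ∂(V.prod (volume : Measure (E n))), ‖q.1.1‖ ≤ R :=
    Measure.quasiMeasurePreserving_fst.ae h
  filter_upwards [h'] with q hq hqK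
  obtain ⟨p, y⟩ := q
  refine h0 p y ?_
  by_contra hle
  push Not at hle
  refine hqK ⟨mem_cylinder.2 hq, ?_⟩
  rw [mem_closedBall_zero_iff]
  have : ‖y‖ ≤ ‖p.1‖ + ‖p.1 - y‖ := by
    calc ‖y‖ = ‖p.1 - (p.1 - y)‖ := by simp
      _ ≤ _ := norm_sub_le _ _
  simp only at hq ⊢
  linarith

lemma SuppIn.integral_integral_inner {V : VMeasure d n} [IsFiniteMeasure V] {R : ℝ}
    (h : SuppIn V R) {w : (E n × Gr d n) × E n → E n} (hw : Continuous w)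
    (h0 : ∀ p y, 1 < ‖p.1 - y‖ → w (p, y) = 0) {u : E n → E n} (hu : Continuous u) :
    ∫ p, (∫ y, ⟪w (p, y), u y⟫) ∂V = ∫ y, ⟪∫ p, w (p, y) ∂V, u y⟫ := by
  have hint : Integrable (Function.uncurry fun p y => ⟪w (p, y), u y⟫) (V.prod volume) := by
    refine h.integrable_prod (by unfold Function.uncurry; fun_prop) fun p y hpy => ?_
    simp [Function.uncurry, h0 p y hpy]
  rw [integral_integral_swap hint]
  refine integral_congr_ae (Eventually.of_forall fun y => ?_)
  have h1 : Integrable (fun p => w (p, y)) V := h.integrable (by fun_prop)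
  simp only
  rw [real_inner_comm, ← integral_inner h1]
  refine integral_congr_ae (Eventually.of_forall fun p => real_inner_comm _ _)

/-! ### The kernel -/

section Kernel

variable {ψ : E n → ℝ} {ε : ℝ}

lemma contDiff_kernel (hψ : IsCutoff ψ) (ε : ℝ) : ContDiff ℝ ∞ (kernel ψ ε) := by
  unfold kernel gaussianKernel
  have h1 := hψ.smooth
  have h2 : ContDiff ℝ ∞ fun x : E n => ‖x‖ ^ 2 := contDiff_norm_sq ℝ
  have h3 : ContDiff ℝ ∞ fun x : E n => Real.exp (-‖x‖ ^ 2 / (2 * ε ^ 2)) :=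
    (h2.neg.div_const _).exp
  exact (contDiff_const.mul h1).mul (contDiff_const.mul h3)

lemma kernel_eq_zero (hψ : IsCutoff ψ) {x : E n} (hx : 1 ≤ ‖x‖) : kernel ψ ε x = 0 := by
  simp [kernel, hψ.eq_zero x hx]

lemma gaussianKernel_nonneg (ε : ℝ) (x : E n) : 0 ≤ gaussianKernel ε x := by
  unfold gaussianKernel; positivity

lemma kernel_nonneg (hψ : IsCutoff ψ) (x : E n) : 0 ≤ kernel ψ ε x := by
  have h1 : 0 ≤ ∫ y, ψ y * gaussianKernel ε y :=
    integral_nonneg fun y => mul_nonneg (hψ.nonneg y) (gaussianKernel_nonneg ε y)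
  exact mul_nonneg (mul_nonneg (by positivity) (hψ.nonneg x)) (gaussianKernel_nonneg ε x)

lemma continuous_kernel (hψ : IsCutoff ψ) (ε : ℝ) : Continuous (kernel ψ ε) :=
  (contDiff_kernel hψ ε).continuous

lemma hasCompactSupport_kernel (hψ : IsCutoff ψ) (ε : ℝ) : HasCompactSupport (kernel ψ ε) :=
  HasCompactSupport.intro (isCompact_closedBall (0 : E n) 1) fun x hx => by
    rw [mem_closedBall_zero_iff, not_le] at hx
    exact kernel_eq_zero hψ hx.le

lemma gradient_kernel_eq_zero (hψ : IsCutoff ψ) {x : E n} (hx : 1 < ‖x‖) :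
    gradient (kernel ψ ε) x = 0 := by
  have h : kernel ψ ε =ᶠ[𝓝 x] fun _ => 0 := by
    filter_upwards [(isOpen_lt continuous_const continuous_norm).mem_nhds hx] with y hy
    exact kernel_eq_zero hψ (le_of_lt hy)
  rw [gradient, h.fderiv_eq]
  simp

lemma continuous_gradient {f : E n → ℝ} (hf : ContDiff ℝ 1 f) : Continuous (gradient f) := by
  unfold gradient
  exact (LinearIsometryEquiv.continuous _).comp (hf.continuous_fderiv (by norm_num))

lemma continuous_gradient_kernel (hψ : IsCutoff ψ) (ε : ℝ) :
    Continuous (gradient (kernel ψ ε)) :=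
  continuous_gradient ((contDiff_kernel hψ ε).of_le (by exact_mod_cast le_top))

lemma norm_gradient (f : E n → ℝ) (x : E n) : ‖gradient f x‖ = ‖fderiv ℝ f x‖ := by
  simp [gradient]

lemma inner_gradient_left (f : E n → ℝ) (x v : E n) : ⟪gradient f x, v⟫ = fderiv ℝ f x v := by
  simp [gradient]

lemma exists_kernel_bound (hψ : IsCutoff ψ) (ε : ℝ) :
    ∃ K > 0, ∀ x, |kernel ψ ε x| ≤ K ∧ ‖gradient (kernel ψ ε) x‖ ≤ K := by
  obtain ⟨K₁, h₁⟩ := (hasCompactSupport_kernel hψ ε).exists_bound_of_continuous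
    (continuous_kernel hψ ε)
  have hc : HasCompactSupport (gradient (kernel ψ ε)) :=
    HasCompactSupport.intro (isCompact_closedBall (0 : E n) 1) fun x hx => by
      rw [mem_closedBall_zero_iff, not_le] at hx
      exact gradient_kernel_eq_zero hψ hx
  obtain ⟨K₂, h₂⟩ := hc.exists_bound_of_continuous (continuous_gradient_kernel hψ ε)
  refine ⟨max 1 (max K₁ K₂), by positivity, fun x => ⟨?_, ?_⟩⟩
  · exact (h₁ x).trans ((le_max_left _ _).trans (le_max_right _ _))
  · exact (h₂ x).trans ((le_max_right _ _).trans (le_max_right _ _))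

/-! ### The approximate mean curvature -/

lemma massConv_eq (hψ : IsCutoff ψ) (V : VMeasure d n) (y : E n) :
    massConv ψ ε V y = ∫ p, kernel ψ ε (p.1 - y) ∂V := by
  have := continuous_kernel hψ ε
  exact integral_mass (g := fun z => kernel ψ ε (z - y)) (by fun_prop)

lemma massConv_nonneg (hψ : IsCutoff ψ) (V : VMeasure d n) (y : E n) :
    0 ≤ massConv ψ ε V y :=
  integral_nonneg fun _ => kernel_nonneg hψ _

lemma continuous_massConv (hψ : IsCutoff ψ) (V : VMeasure d n) [IsFiniteMeasure V] :
    Continuous (massConv ψ ε V) := by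
  have h : massConv ψ ε V = fun y => ∫ p, kernel ψ ε (p.1 - y) ∂V := by
    funext y; exact massConv_eq hψ V y
  have hk := continuous_kernel hψ ε
  obtain ⟨K, _, hK⟩ := exists_kernel_bound hψ ε
  rw [h]
  refine continuous_of_dominated (bound := fun _ => K) (fun y => ?_) (fun y => ?_)
    (integrable_const K) ?_
  · exact (by fun_prop : Continuous fun p : E n × Gr d n => kernel ψ ε (p.1 - y)
      ).aestronglyMeasurable
  · exact Eventually.of_forall fun p => (hK _).1
  · exact Eventually.of_forall fun p => by fun_prop

lemma continuous_apply_gradient_kernel (hψ : IsCutoff ψ) (ε : ℝ) :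
    Continuous fun q : (E n × Gr d n) × E n =>
      q.1.2.1 (gradient (kernel ψ ε) (q.1.1 - q.2)) := by
  have hk := continuous_gradient_kernel hψ ε
  exact (continuous_subtype_val.comp (continuous_snd.comp continuous_fst)).clm_apply (by fun_prop)

lemma continuous_firstVariationConv (hψ : IsCutoff ψ) (V : VMeasure d n) [IsFiniteMeasure V] :
    Continuous (firstVariationConv ψ ε V) := by
  have hk := continuous_apply_gradient_kernel (d := d) hψ ε
  obtain ⟨K, _, hK⟩ := exists_kernel_bound hψ ε
  unfold firstVariationConv
  refine continuous_of_dominated (bound := fun _ => K) (fun y => ?_) (fun y => ?_)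
    (integrable_const K) ?_
  · exact (hk.comp (by fun_prop : Continuous fun p : E n × Gr d n => (p, y))
      ).aestronglyMeasurable
  · exact Eventually.of_forall fun p => (p.2.norm_apply_le _).trans (hK _).2
  · exact Eventually.of_forall fun p => hk.comp (by fun_prop : Continuous fun y : E n => (p, y))

lemma continuous_preCurvature (hψ : IsCutoff ψ) (hε : 0 < ε) (V : VMeasure d n)
    [IsFiniteMeasure V] : Continuous (preCurvature ψ ε V) := by
  have h1 := continuous_massConv (ε := ε) hψ V
  have h2 := continuous_firstVariationConv (ε := ε) hψ V
  unfold preCurvature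
  refine (((h1.add continuous_const).inv₀ fun y => ?_).smul h2).neg
  exact (add_pos_of_nonneg_of_pos (massConv_nonneg hψ V y) hε).ne'

lemma norm_preCurvature_le (hψ : IsCutoff ψ) (hε : 0 < ε) {K : ℝ}
    (hK : ∀ x, ‖gradient (kernel ψ ε) x‖ ≤ K) (V : VMeasure d n) [IsFiniteMeasure V] (y : E n) :
    ‖preCurvature ψ ε V y‖ ≤ ε⁻¹ * (K * V.real univ) := by
  unfold preCurvature
  have h0 := massConv_nonneg (ε := ε) hψ V y
  rw [norm_neg, norm_smul, Real.norm_eq_abs, abs_of_nonneg (by positivity)]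
  gcongr
  · linarith
  · exact norm_integral_le_of_norm_le_const
      (Eventually.of_forall fun p => (p.2.norm_apply_le _).trans (hK _))

lemma norm_integral_le_of_unit_ball {F : Type*} [NormedAddCommGroup F] [NormedSpace ℝ F]
    {f : E n → F} {x : E n} {C : ℝ} (hC : ∀ y, ‖f y‖ ≤ C) (h0 : ∀ y, 1 < ‖x - y‖ → f y = 0) :
    ‖∫ y, f y‖ ≤ C * volume.real (Metric.closedBall (0 : E n) 1) := by
  have h1 : ∀ y, y ∉ Metric.closedBall x 1 → f y = 0 := fun y hy => h0 y (by
    rwa [Metric.mem_closedBall, dist_comm, dist_eq_norm, not_le] at hy)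
  rw [← setIntegral_eq_integral_of_forall_compl_eq_zero h1]
  refine (norm_setIntegral_le_of_norm_le_const measure_closedBall_lt_top fun y _ => hC y).trans
    (le_of_eq ?_)
  simp only [Measure.real, Measure.addHaar_closedBall_center volume x]

/-- `h_ε` is a convolution of the merely continuous field `h̃_ε` with a smooth compactly supported
kernel, so the derivative falls on the kernel. The kernel is the right factor, hence the flipped
scalar multiplication. -/
lemma hasFDerivAt_approxCurvature (hψ : IsCutoff ψ) (hε : 0 < ε) (V : VMeasure d n)
    [IsFiniteMeasure V] (x : E n) :
    HasFDerivAt (approxCurvature ψ ε V)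
      (∫ y, (fderiv ℝ (kernel ψ ε) (x - y)).smulRight (preCurvature ψ ε V y)) x := by
  have h : HasFDerivAt (approxCurvature ψ ε V) _ x :=
    HasCompactSupport.hasFDerivAt_convolution_right (μ := (volume : Measure (E n)))
    (ContinuousLinearMap.lsmul ℝ ℝ (E := E n)).flip
    (hasCompactSupport_kernel hψ ε) (continuous_preCurvature hψ hε V).locallyIntegrable
    ((contDiff_kernel hψ ε).of_le (by exact_mod_cast le_top)) x
  refine h.congr_fderiv (integral_congr_ae (Eventually.of_forall fun y => ?_))
  refine ContinuousLinearMap.ext fun v => ?_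
  simp [ContinuousLinearMap.precompR]

lemma contDiff_approxCurvature (hψ : IsCutoff ψ) (hε : 0 < ε) (V : VMeasure d n)
    [IsFiniteMeasure V] : ContDiff ℝ 1 (approxCurvature ψ ε V) :=
  HasCompactSupport.contDiff_convolution_right (μ := (volume : Measure (E n)))
    (ContinuousLinearMap.lsmul ℝ ℝ (E := E n)).flip
    (hasCompactSupport_kernel hψ ε) (continuous_preCurvature hψ hε V).locallyIntegrable
    ((contDiff_kernel hψ ε).of_le (by exact_mod_cast le_top))

/-- The approximate mean curvature is bounded in `C¹` by a multiple of the mass. -/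
lemma exists_approxCurvature_bound (d : ℕ) (hψ : IsCutoff ψ) (hε : 0 < ε) :
    ∃ C > 0, ∀ (V : VMeasure d n) [IsFiniteMeasure V], ∀ x,
      ‖approxCurvature ψ ε V x‖ ≤ C * V.real univ ∧
      ‖fderiv ℝ (approxCurvature ψ ε V) x‖ ≤ C * V.real univ := by
  obtain ⟨K, hK0, hK⟩ := exists_kernel_bound hψ ε
  -- `K` bounds the kernel and its gradient, `ε⁻¹ K` times the mass bounds `h̃_ε`, and the integrand
  -- lives on a unit ball. The summand `1` only ensures positivity.
  refine ⟨K * (ε⁻¹ * K) * volume.real (Metric.closedBall (0 : E n) 1) + 1, by positivity, ?_⟩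
  intro V _ x
  have hp := norm_preCurvature_le hψ hε (fun x => (hK x).2) V
  have hm : 0 ≤ V.real univ := measureReal_nonneg
  have hle : K * (ε⁻¹ * (K * V.real univ)) * volume.real (Metric.closedBall (0 : E n) 1) ≤
      (K * (ε⁻¹ * K) * volume.real (Metric.closedBall (0 : E n) 1) + 1) * V.real univ := by
    linarith
  constructor
  · refine le_trans (norm_integral_le_of_unit_ball (x := x) (fun y => ?_) fun y hy => ?_) hle
    · rw [norm_smul]
      exact mul_le_mul (hK _).1 (hp y) (norm_nonneg _) hK0.le
    · rw [kernel_eq_zero hψ hy.le, zero_smul]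
  · rw [(hasFDerivAt_approxCurvature hψ hε V x).fderiv]
    refine le_trans (norm_integral_le_of_unit_ball (x := x) (fun y => ?_) fun y hy => ?_) hle
    · rw [ContinuousLinearMap.norm_smulRight_apply, ← norm_gradient]
      exact mul_le_mul (hK _).2 (hp y) (norm_nonneg _) hK0.le
    · have : fderiv ℝ (kernel ψ ε) (x - y) = 0 := by
        rw [← norm_eq_zero, ← norm_gradient, gradient_kernel_eq_zero hψ hy, norm_zero]
      rw [this]
      ext; simp

lemma integrable_of_unit_ball {F : Type*} [NormedAddCommGroup F]
    {f : E n → F} {x : E n} (hf : Continuous f) (h0 : ∀ y, 1 < ‖x - y‖ → f y = 0) :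
    Integrable f :=
  hf.integrable_of_hasCompactSupport <|
    HasCompactSupport.intro (isCompact_closedBall x 1) fun y hy => h0 y (by
      rwa [Metric.mem_closedBall, dist_comm, dist_eq_norm, not_le] at hy)

/-- Under the integral, `Dh_ε` is the rank-one map `v ↦ ⟪∇Φ_ε(x - y), v⟫ h̃_ε(y)`, whose composition
with `S` has trace `⟪∇Φ_ε(x - y), S h̃_ε(y)⟫`; then `S` is moved to the other side by symmetry. -/
lemma tangentialDiv_approxCurvature (hψ : IsCutoff ψ) (hε : 0 < ε) (V : VMeasure d n)
    [IsFiniteMeasure V] (x : E n) (S : Gr d n) :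
    tangentialDiv (approxCurvature ψ ε V) x S =
      ∫ y, ⟪S.1 (gradient (kernel ψ ε) (x - y)), preCurvature ψ ε V y⟫ := by
  rw [tangentialDiv_eq, (hasFDerivAt_approxCurvature hψ hε V x).fderiv]
  let L : (E n →L[ℝ] E n) →L[ℝ] ℝ :=
    (traceCLM n).comp (ContinuousLinearMap.compL ℝ (E n) (E n) (E n) S.1)
  have hfk : Continuous (fderiv ℝ (kernel ψ ε)) :=
    (contDiff_kernel hψ ε).continuous_fderiv (by simp)
  have hpc := continuous_preCurvature hψ hε V
  have hint : Integrable fun y =>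
      (fderiv ℝ (kernel ψ ε) (x - y)).smulRight (preCurvature ψ ε V y) := by
    refine integrable_of_unit_ball (x := x) ?_ fun y hy => ?_
    · exact (((ContinuousLinearMap.smulRightL ℝ (E n) (E n)).continuous.comp
        (hfk.comp (continuous_const.sub continuous_id))).clm_apply hpc)
    · have : fderiv ℝ (kernel ψ ε) (x - y) = 0 := by
        rw [← norm_eq_zero, ← norm_gradient, gradient_kernel_eq_zero hψ hy, norm_zero]
      rw [this]
      ext; simp
  change L (∫ y, _) = _
  rw [← L.integral_comp_comm hint]
  refine integral_congr_ae (Eventually.of_forall fun y => ?_)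
  have e : S.1 ∘L (fderiv ℝ (kernel ψ ε) (x - y)).smulRight (preCurvature ψ ε V y) =
      (fderiv ℝ (kernel ψ ε) (x - y)).smulRight (S.1 (preCurvature ψ ε V y)) := by
    ext1 v; simp
  change traceCLM n (S.1 ∘L (fderiv ℝ (kernel ψ ε) (x - y)).smulRight (preCurvature ψ ε V y)) = _
  simp only
  rw [e, traceCLM_apply, S.inner_apply_left, inner_gradient_left]
  exact LinearMap.trace_smulRight _ _

/-- The vector field which, integrated against `V`, is the density of the first variation
weighted by `φ` with respect to the field `y ↦ Φ_ε(· - y)`; here `φ` and its gradient are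
given by their values `s` and `g`. -/
noncomputable def weightedKernel (ψ : E n → ℝ) (ε : ℝ) (s : ℝ) (g : E n) (p : E n × Gr d n) (y : E n) : E n :=
  s • p.2.1 (gradient (kernel ψ ε) (p.1 - y)) + kernel ψ ε (p.1 - y) • g

lemma weightedKernel_eq_zero (hψ : IsCutoff ψ) {s : ℝ} {g : E n} {p : E n × Gr d n} {y : E n}
    (h : 1 < ‖p.1 - y‖) : weightedKernel ψ ε s g p y = 0 := by
  simp [weightedKernel, gradient_kernel_eq_zero hψ h, kernel_eq_zero hψ h.le]

lemma continuous_weightedKernel (hψ : IsCutoff ψ) (ε : ℝ) {Z : Type*} [TopologicalSpace Z]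
    {s : Z → ℝ} {g : Z → E n} {p : Z → E n × Gr d n} {y : Z → E n} (hs : Continuous s)
    (hg : Continuous g) (hp : Continuous p) (hy : Continuous y) :
    Continuous fun z => weightedKernel ψ ε (s z) (g z) (p z) (y z) := by
  unfold weightedKernel
  have h1 := (continuous_apply_gradient_kernel (d := d) hψ ε).comp (hp.prodMk hy)
  have h2 := (continuous_kernel hψ ε).comp (hp.fst.sub hy)
  exact (hs.smul h1).add (h2.smul hg)

lemma integral_inner_weightedKernel (hψ : IsCutoff ψ) (hε : 0 < ε) (V : VMeasure d n)
    [IsFiniteMeasure V] (s : ℝ) (g : E n) (p : E n × Gr d n) :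
    ∫ y, ⟪weightedKernel ψ ε s g p y, preCurvature ψ ε V y⟫ =
      s * tangentialDiv (approxCurvature ψ ε V) p.1 p.2 + ⟪g, approxCurvature ψ ε V p.1⟫ := by
  have hpc := continuous_preCurvature hψ hε V
  have hk := continuous_kernel hψ ε
  have hgk := continuous_gradient_kernel hψ ε
  have i1 : Integrable fun y =>
      ⟪p.2.1 (gradient (kernel ψ ε) (p.1 - y)), preCurvature ψ ε V y⟫ := by
    refine integrable_of_unit_ball (x := p.1) (by fun_prop) fun y hy => ?_
    rw [gradient_kernel_eq_zero hψ hy]; simp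
  have i2 : Integrable fun y => kernel ψ ε (p.1 - y) • preCurvature ψ ε V y := by
    refine integrable_of_unit_ball (x := p.1) (by fun_prop) fun y hy => ?_
    rw [kernel_eq_zero hψ hy.le]; simp
  rw [tangentialDiv_approxCurvature hψ hε, approxCurvature, ← integral_inner i2,
    ← integral_const_mul, ← integral_add (i1.const_mul s) (i2.const_inner g)]
  refine integral_congr_ae (Eventually.of_forall fun y => ?_)
  simp only [weightedKernel, inner_add_left, real_inner_smul_left, real_inner_smul_right]

lemma continuous_tangentialDiv {X : E n → E n} (hX : ContDiff ℝ 1 X) :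
    Continuous fun p : E n × Gr d n => tangentialDiv X p.1 p.2 := by
  have h := hX.continuous_fderiv (by norm_num)
  simp only [tangentialDiv_eq]
  exact (traceCLM n).continuous.comp ((continuous_subtype_val.comp continuous_snd).mul
    (h.comp continuous_fst))

/-- Fubini for the first variation in the direction of the approximate mean curvature. -/
lemma SuppIn.weightedFirstVariation_eq (hψ : IsCutoff ψ) (hε : 0 < ε) {V : VMeasure d n}
    [IsFiniteMeasure V] {R : ℝ} (h : SuppIn V R) {φ : E n → ℝ} (hφ : ContDiff ℝ 1 φ) :
    weightedFirstVariation V φ (approxCurvature ψ ε V) =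
      ∫ y, ⟪∫ p, weightedKernel ψ ε (φ p.1) (gradient φ p.1) p y ∂V, preCurvature ψ ε V y⟫ := by
  have hg := continuous_gradient hφ
  have hc := hφ.continuous
  have hA := contDiff_approxCurvature hψ hε V
  have hA' := hA.continuous
  have hd := continuous_tangentialDiv (d := d) hA
  rw [← h.integral_integral_inner (w := fun q => weightedKernel ψ ε (φ q.1.1) (gradient φ q.1.1)
    q.1 q.2) (continuous_weightedKernel hψ ε (by fun_prop) (by fun_prop) (by fun_prop)
    (by fun_prop)) (fun p y hpy => weightedKernel_eq_zero hψ hpy)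
    (continuous_preCurvature hψ hε V)]
  simp only [integral_inner_weightedKernel hψ hε]
  unfold weightedFirstVariation
  rw [integral_add]
  · exact h.integrable (by fun_prop)
  · exact h.integrable (by fun_prop)

/-- The first variation is nonpositive in the direction of the approximate mean curvature. -/
lemma SuppIn.firstVariation_nonpos (hψ : IsCutoff ψ) (hε : 0 < ε) {V : VMeasure d n}
    [IsFiniteMeasure V] {R : ℝ} (h : SuppIn V R) :
    ∫ p, tangentialDiv (approxCurvature ψ ε V) p.1 p.2 ∂V ≤ 0 := by
  have h1 := h.weightedFirstVariation_eq hψ hε (φ := fun _ => 1) contDiff_const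
  have hg : gradient (fun _ : E n => (1 : ℝ)) = fun _ => 0 := by
    funext x; simp [gradient]
  simp only [weightedFirstVariation, hg, inner_zero_left, integral_zero, one_mul, add_zero,
    weightedKernel, one_smul, smul_zero] at h1
  rw [h1]
  refine integral_nonpos fun y => ?_
  -- For the weight `1` the inner integral is exactly `δV * Φ_ε`, and `h̃_ε` is a negative multiple
  -- of it, so the integrand is minus a square.
  change ⟪firstVariationConv ψ ε V y, preCurvature ψ ε V y⟫ ≤ 0
  rw [preCurvature, inner_neg_right, real_inner_smul_right, real_inner_self_eq_norm_sq]
  have := massConv_nonneg (ε := ε) hψ V y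
  have : 0 ≤ (massConv ψ ε V y + ε)⁻¹ * ‖firstVariationConv ψ ε V y‖ ^ 2 := by positivity
  simpa using this

end Kernel

/-! ### Test functions on space-time -/

section TestFunction

variable {φ : ℝ → E n → ℝ}

/-- The class of `C¹` functions on `[0, 1] × ℝⁿ`. -/
def IsTest (φ : ℝ → E n → ℝ) : Prop :=
  ContDiffOn ℝ 1 (fun p : ℝ × E n => φ p.1 p.2) (Icc (0 : ℝ) 1 ×ˢ univ)

/-- The space-time derivative, one-sided at the times `0` and `1`. -/
noncomputable def spaceTimeDeriv (φ : ℝ → E n → ℝ) (q : ℝ × E n) : ℝ × E n →L[ℝ] ℝ :=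
  fderivWithin ℝ (fun p : ℝ × E n => φ p.1 p.2) (Icc (0 : ℝ) 1 ×ˢ univ) q

lemma uniqueDiffOn_slab : UniqueDiffOn ℝ (Icc (0 : ℝ) 1 ×ˢ (univ : Set (E n))) :=
  (uniqueDiffOn_Icc zero_lt_one).prod uniqueDiffOn_univ

lemma IsTest.continuousOn (hφ : IsTest φ) :
    ContinuousOn (fun p : ℝ × E n => φ p.1 p.2) (Icc (0 : ℝ) 1 ×ˢ univ) :=
  ContDiffOn.continuousOn hφ

lemma IsTest.continuousOn_spaceTimeDeriv (hφ : IsTest φ) :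
    ContinuousOn (spaceTimeDeriv φ) (Icc (0 : ℝ) 1 ×ˢ univ) :=
  ContDiffOn.continuousOn_fderivWithin hφ uniqueDiffOn_slab (by norm_num)

lemma IsTest.hasFDerivWithinAt (hφ : IsTest φ) {t : ℝ} (ht : t ∈ Icc (0 : ℝ) 1) (x : E n) :
    HasFDerivWithinAt (fun p : ℝ × E n => φ p.1 p.2) (spaceTimeDeriv φ (t, x))
      (Icc (0 : ℝ) 1 ×ˢ univ) (t, x) :=
  (ContDiffOn.differentiableOn hφ (by norm_num) (t, x) ⟨ht, mem_univ _⟩).hasFDerivWithinAt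

lemma IsTest.contDiff (hφ : IsTest φ) {t : ℝ} (ht : t ∈ Icc (0 : ℝ) 1) : ContDiff ℝ 1 (φ t) := by
  rw [← contDiffOn_univ]
  have h : ContDiffOn ℝ 1 (fun x : E n => (t, x)) univ :=
    (contDiff_const.prodMk contDiff_id).contDiffOn
  have hφ' : ContDiffOn ℝ 1 (fun p : ℝ × E n => φ p.1 p.2) (Icc (0 : ℝ) 1 ×ˢ univ) := hφ
  exact hφ'.comp h fun x _ => ⟨ht, mem_univ _⟩

lemma IsTest.inner_gradient (hφ : IsTest φ) {t : ℝ} (ht : t ∈ Icc (0 : ℝ) 1) (x v : E n) :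
    ⟪gradient (φ t) x, v⟫ = spaceTimeDeriv φ (t, x) (0, v) := by
  rw [inner_gradient_left]
  have h1 : HasFDerivWithinAt (fun x : E n => (t, x)) (ContinuousLinearMap.inr ℝ ℝ (E n)) univ x :=
    (hasFDerivAt_prodMk_right t x).hasFDerivWithinAt
  have h := (hφ.hasFDerivWithinAt ht x).comp x h1 fun y _ => ⟨ht, mem_univ _⟩
  rw [hasFDerivWithinAt_univ] at h
  have h2 : fderiv ℝ (φ t) x = _ := h.fderiv
  rw [h2]; rfl

lemma IsTest.derivWithin_eq (hφ : IsTest φ) {t : ℝ} (ht : t ∈ Icc (0 : ℝ) 1) (x : E n) :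
    derivWithin (fun s => φ s x) (Icc 0 1) t = spaceTimeDeriv φ (t, x) (1, 0) := by
  have h1 : HasFDerivWithinAt (fun s : ℝ => (s, x)) (ContinuousLinearMap.inl ℝ ℝ (E n))
      (Icc 0 1) t := (hasFDerivAt_prodMk_left t x).hasFDerivWithinAt
  have h0 : MapsTo (fun s : ℝ => (s, x)) (Icc 0 1) (Icc (0 : ℝ) 1 ×ˢ univ) :=
    fun y hy => ⟨hy, mem_univ _⟩
  have h := (hφ.hasFDerivWithinAt ht x).comp t h1 h0
  have h2 := h.hasDerivWithinAt.derivWithin (uniqueDiffOn_Icc zero_lt_one t ht)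
  exact h2

lemma isCompact_slab (R : ℝ) : IsCompact (Icc (0 : ℝ) 1 ×ˢ Metric.closedBall (0 : E n) R) :=
  isCompact_Icc.prod (isCompact_closedBall _ _)

/-- First-order Taylor expansion, uniform on bounded sets. -/
lemma IsTest.exists_expansion (hφ : IsTest φ) (R : ℝ) {B : ℝ} (hB : 0 ≤ B) {η : ℝ} (hη : 0 < η) :
    ∃ τ₀ > 0, ∀ t τ : ℝ, 0 ≤ t → 0 ≤ τ → t + τ ≤ 1 → τ ≤ τ₀ → ∀ x v : E n, ‖x‖ ≤ R → ‖v‖ ≤ B →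
      |φ (t + τ) (x + τ • v) - φ t x - τ * spaceTimeDeriv φ (t, x) (1, v)| ≤ η * τ := by
  set K := Icc (0 : ℝ) 1 ×ˢ Metric.closedBall (0 : E n) (R + B) with hK
  have hsub : K ⊆ Icc (0 : ℝ) 1 ×ˢ univ := prod_mono le_rfl (subset_univ _)
  have huc := (isCompact_slab (n := n) (R + B)).uniformContinuousOn_of_continuous
    (hφ.continuousOn_spaceTimeDeriv.mono hsub)
  obtain ⟨δ, hδ, hδ'⟩ := Metric.uniformContinuousOn_iff_le.1 huc (η / (1 + B)) (by positivity)
  refine ⟨δ / (1 + B), by positivity, fun t τ ht hτ h1 hτ₀ x v hx hv => ?_⟩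
  have hτ1 : τ ≤ 1 := by linarith
  have hτδ : τ * (1 + B) ≤ δ := by rwa [le_div_iff₀ (by positivity)] at hτ₀
  have hmem : ((t, x) : ℝ × E n) ∈ K := ⟨⟨ht, by linarith⟩, by
    rw [mem_closedBall_zero_iff]; linarith⟩
  have hmem' : ((t + τ, x + τ • v) : ℝ × E n) ∈ K := ⟨⟨by linarith, h1⟩, by
    rw [mem_closedBall_zero_iff]
    refine (norm_add_le _ _).trans (add_le_add hx ?_)
    rw [norm_smul, Real.norm_eq_abs, abs_of_nonneg hτ]
    calc τ * ‖v‖ ≤ 1 * B := by gcongr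
      _ = B := one_mul B⟩
  set q : ℝ × E n := (t, x) with hq
  set q' : ℝ × E n := (t + τ, x + τ • v) with hq'
  have hdiff : q' - q = τ • ((1, v) : ℝ × E n) := by simp [hq, hq']
  have hnorm : ‖q' - q‖ ≤ τ * (1 + B) := by
    rw [hdiff, norm_smul, Real.norm_eq_abs, abs_of_nonneg hτ]
    gcongr
    rw [Prod.norm_def]
    simp only [norm_one]
    exact max_le (by linarith) (by linarith)
  -- On this convex set the derivative differs from its value at `q` by at most `η / (1 + B)`, so
  -- the mean value inequality applies to the function minus its linear part at `q`.
  set s := K ∩ Metric.closedBall q (τ * (1 + B)) with hs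
  have hconv : Convex ℝ s :=
    ((convex_Icc 0 1).prod (convex_closedBall _ _)).inter (convex_closedBall _ _)
  have hmain := hconv.norm_image_sub_le_of_norm_hasFDerivWithin_le'
    (f := fun p : ℝ × E n => φ p.1 p.2) (f' := spaceTimeDeriv φ) (φ := spaceTimeDeriv φ q)
    (C := η / (1 + B)) (x := q) (y := q')
    (fun z hz => ((hφ.hasFDerivWithinAt hz.1.1 z.2).mono (fun y hy => hsub hy.1) ))
    (fun z hz => by
      rw [← dist_eq_norm]
      exact hδ' z hz.1 q hmem (hz.2.trans hτδ))
    ⟨hmem, Metric.mem_closedBall_self (by positivity)⟩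
    ⟨hmem', by rwa [Metric.mem_closedBall, dist_eq_norm]⟩
  have e : spaceTimeDeriv φ q (q' - q) = τ * spaceTimeDeriv φ (t, x) (1, v) := by
    rw [hdiff, map_smul, smul_eq_mul]
  rw [e, Real.norm_eq_abs] at hmain
  refine hmain.trans ?_
  calc η / (1 + B) * ‖q' - q‖ ≤ η / (1 + B) * (τ * (1 + B)) := by gcongr
    _ = η * τ := by field_simp

end TestFunction

/-! ### Push-forward by a map close to the identity -/

section PushForward

variable {X : E n → E n} {B τ : ℝ}

lemma fderiv_id_add_smul (hX : ContDiff ℝ 1 X) (τ : ℝ) (x : E n) :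
    fderiv ℝ (fun x => x + τ • X x) x = 1 + τ • fderiv ℝ X x :=
  ((hasFDerivAt_id x).add
    ((hX.differentiable (by norm_num) x).hasFDerivAt.const_smul τ)).fderiv

/-- Vector fields that are `C¹`, bounded by `B` together with their derivatives. -/
structure C1Bound (X : E n → E n) (B : ℝ) : Prop where
  contDiff : ContDiff ℝ 1 X
  nonneg : 0 ≤ B
  norm_le : ∀ x, ‖X x‖ ≤ B
  norm_fderiv_le : ∀ x, ‖fderiv ℝ X x‖ ≤ B

lemma C1Bound.norm_smul_fderiv_le (h : C1Bound X B) (hτ : 0 ≤ τ) (x : E n) :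
    ‖τ • fderiv ℝ X x‖ ≤ τ * B := by
  rw [norm_smul, Real.norm_eq_abs, abs_of_nonneg hτ]
  exact mul_le_mul_of_nonneg_left (h.norm_fderiv_le x) hτ

lemma norm_le_two_mul_one_add {L : E n →L[ℝ] E n} (hL : ‖L‖ ≤ 1 / 2) (u : E n) :
    ‖u‖ ≤ 2 * ‖(1 + L) u‖ := by
  have h1 : ‖L u‖ ≤ 1 / 2 * ‖u‖ := (L.le_opNorm u).trans (by gcongr)
  have h2 : ‖u‖ ≤ ‖(1 + L) u‖ + ‖L u‖ := by
    calc ‖u‖ = ‖(1 + L) u - L u‖ := by simp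
      _ ≤ _ := norm_sub_le _ _
  linarith

lemma norm_one_add_le_two {L : E n →L[ℝ] E n} (hL : ‖L‖ ≤ 1 / 2) : ‖1 + L‖ ≤ 2 := by
  have h1 : ‖(1 : E n →L[ℝ] E n)‖ ≤ 1 := ContinuousLinearMap.norm_id_le
  calc ‖1 + L‖ ≤ ‖(1 : E n →L[ℝ] E n)‖ + ‖L‖ := norm_add_le _ _
    _ ≤ 2 := by linarith

/-- The action of `id + τ X` on pairs of points and planes. -/
noncomputable def moveMap (X : E n → E n) (τ : ℝ) (p : E n × Gr d n) : E n × Gr d n :=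
  (p.1 + τ • X p.1, imagePlane (1 + τ • fderiv ℝ X p.1) p.2)

/-- The tangential Jacobian of `id + τ X`. -/
noncomputable def moveJac (X : E n → E n) (τ : ℝ) (p : E n × Gr d n) : ℝ :=
  tangentialJacobian (1 + τ • fderiv ℝ X p.1) p.2

/-- The condition `τ B ≤ 1/2` makes `1 + τ DX` bounded below, so `imagePlane` never takes its
default branch and the estimate `dist_imagePlane_le` applies. -/
lemma C1Bound.continuous_moveMap (h : C1Bound X B) (hτ : 0 ≤ τ) (hτB : τ * B ≤ 1 / 2) :
    Continuous (moveMap (d := d) X τ) := by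
  have hX := h.contDiff.continuous
  have hX' := h.contDiff.continuous_fderiv (by norm_num)
  refine (by fun_prop : Continuous fun p : E n × Gr d n => p.1 + τ • X p.1).prodMk ?_
  refine continuous_iff_continuousAt.2 fun p₀ => ?_
  have hb : ∀ x, ‖τ • fderiv ℝ X x‖ ≤ 1 / 2 := fun x => (h.norm_smul_fderiv_le hτ x).trans hτB
  have hc : Continuous fun p : E n × Gr d n =>
      4 * dist (1 + τ • fderiv ℝ X p.1) (1 + τ • fderiv ℝ X p₀.1) + 8 * dist p.2 p₀.2 := by
    have : Continuous fun p : E n × Gr d n => 1 + τ • fderiv ℝ X p.1 :=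
      continuous_const.add ((hX'.comp continuous_fst).const_smul τ)
    exact (continuous_const.mul (this.dist continuous_const)).add
      (continuous_const.mul (continuous_snd.dist continuous_const))
  refine tendsto_iff_dist_tendsto_zero.2 (squeeze_zero (fun _ => dist_nonneg) (fun p =>
    dist_imagePlane_le (norm_le_two_mul_one_add (hb p.1)) (norm_le_two_mul_one_add (hb p₀.1))
      (norm_one_add_le_two (hb _)) (norm_one_add_le_two (hb _)) _ _) ?_)
  simpa using hc.tendsto p₀

lemma C1Bound.continuous_moveJac (h : C1Bound X B) (τ : ℝ) :
    Continuous (moveJac (d := d) X τ) := by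
  have hX' := h.contDiff.continuous_fderiv (by norm_num)
  exact continuous_tangentialJacobian.comp ((continuous_const.add
    ((hX'.comp continuous_fst).const_smul τ)).prodMk continuous_snd)

lemma C1Bound.dist_moveMap_le (h : C1Bound X B) (hτ : 0 ≤ τ) (hτB : τ * B ≤ 1 / 2)
    (p : E n × Gr d n) : dist (moveMap X τ p) p ≤ 4 * (τ * B) := by
  have hb : ‖τ • fderiv ℝ X p.1‖ ≤ 1 / 2 := (h.norm_smul_fderiv_le hτ p.1).trans hτB
  have h0 : 0 ≤ τ * B := mul_nonneg hτ h.nonneg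
  rw [Prod.dist_eq]
  refine max_le ?_ ?_
  · simp only [moveMap, dist_self_add_left]
    rw [norm_smul, Real.norm_eq_abs, abs_of_nonneg hτ]
    have := mul_le_mul_of_nonneg_left (h.norm_le p.1) hτ
    linarith
  · have h1 := dist_imagePlane_le (norm_le_two_mul_one_add hb)
      (norm_le_two_mul_one_add (L := 0) (by simp)) (norm_one_add_le_two hb)
      (norm_one_add_le_two (L := 0) (by simp)) p.2 p.2
    rw [add_zero, imagePlane_one, dist_self, mul_zero, add_zero] at h1
    refine h1.trans ?_
    have h2 : dist (1 + τ • fderiv ℝ X p.1) 1 ≤ τ * B := by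
      rw [dist_eq_norm, add_sub_cancel_left]
      exact h.norm_smul_fderiv_le hτ _
    linarith

lemma pushForward_eq (hX : ContDiff ℝ 1 X) (τ : ℝ) (V : VMeasure d n) :
    pushForward (fun x => x + τ • X x) V =
      (V.withDensity fun p => ENNReal.ofReal (moveJac X τ p)).map (moveMap X τ) := by
  unfold pushForward moveJac moveMap
  simp only [fderiv_id_add_smul hX]

lemma C1Bound.integral_pushForward (h : C1Bound X B) (hτ : 0 ≤ τ) (hτB : τ * B ≤ 1 / 2)
    (V : VMeasure d n) {g : E n × Gr d n → ℝ} (hg : Continuous g) :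
    ∫ p, g p ∂(pushForward (fun x => x + τ • X x) V) =
      ∫ p, moveJac X τ p * g (moveMap X τ p) ∂V := by
  rw [pushForward_eq h.contDiff, integral_map
    (h.continuous_moveMap hτ hτB).measurable.aemeasurable hg.aestronglyMeasurable,
    integral_withDensity_eq_integral_toReal_smul
      (h.continuous_moveJac τ).measurable.ennreal_ofReal (by simp)]
  simp only [moveJac, ENNReal.toReal_ofReal (tangentialJacobian_nonneg _ _), smul_eq_mul]

lemma C1Bound.isFiniteMeasure_pushForward (h : C1Bound X B) (τ : ℝ) {V : VMeasure d n}
    [IsFiniteMeasure V] {R : ℝ} (hV : SuppIn V R) :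
    IsFiniteMeasure (pushForward (fun x => x + τ • X x) V) := by
  rw [pushForward_eq h.contDiff]
  have : IsFiniteMeasure (V.withDensity fun p => ENNReal.ofReal (moveJac X τ p)) :=
    isFiniteMeasure_withDensity_ofReal (hV.integrable (h.continuous_moveJac τ)).2
  infer_instance

lemma C1Bound.suppIn_pushForward (h : C1Bound X B) (hτ : 0 ≤ τ) (hτB : τ * B ≤ 1 / 2)
    {V : VMeasure d n} {R : ℝ} (hV : SuppIn V R) :
    SuppIn (pushForward (fun x => x + τ • X x) V) (R + τ * B) := by
  rw [pushForward_eq h.contDiff, SuppIn, ae_map_iff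
    (h.continuous_moveMap hτ hτB).measurable.aemeasurable
    (isClosed_le (by fun_prop) continuous_const).measurableSet]
  refine (withDensity_absolutelyContinuous _ _).ae_le ?_
  refine Filter.Eventually.mono hV fun p hp => ?_
  refine (norm_add_le _ _).trans (add_le_add hp ?_)
  rw [norm_smul, Real.norm_eq_abs, abs_of_nonneg hτ]
  exact mul_le_mul_of_nonneg_left (h.norm_le p.1) hτ

end PushForward

/-! ### Variation of a varifold under a small push-forward -/

lemma abs_tangentialDiv_le {X : E n → E n} {B : ℝ} (h : C1Bound X B) (x : E n) (S : Gr d n) :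
    |tangentialDiv X x S| ≤ ‖traceCLM n‖ * B := by
  rw [tangentialDiv_eq, ← Real.norm_eq_abs]
  refine ((traceCLM n).le_opNorm _).trans (mul_le_mul_of_nonneg_left ?_ (norm_nonneg _))
  calc ‖S.1 * fderiv ℝ X x‖ ≤ ‖S.1‖ * ‖fderiv ℝ X x‖ := norm_mul_le _ _
    _ ≤ 1 * B := mul_le_mul S.norm_le_one (h.norm_fderiv_le x) (norm_nonneg _) zero_le_one
    _ = B := one_mul B

lemma exists_moveJac_expansion (d n : ℕ) (B : ℝ) {δ : ℝ} (hδ : 0 < δ) :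
    ∃ τ₀ > 0, ∀ X : E n → E n, C1Bound X B → ∀ τ, 0 ≤ τ → τ ≤ τ₀ → τ * B ≤ 1 / 2 ∧
      ∀ p : E n × Gr d n,
        |moveJac X τ p - 1 - τ * tangentialDiv X p.1 p.2| ≤ δ * (τ * B) := by
  obtain ⟨r, hr, hJ⟩ := exists_tangentialJacobian_expansion n hδ
  -- The threshold must be chosen before a field `X`, and with it the sign of `B`, is available;
  -- hence the absolute value.
  refine ⟨min r (1 / 2) / (|B| + 1), by positivity, fun X hX τ hτ hτ₀ => ?_⟩
  rw [le_div_iff₀ (by positivity), abs_of_nonneg hX.nonneg] at hτ₀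
  have h1 : τ * B ≤ min r (1 / 2) := by linarith
  refine ⟨h1.trans (min_le_right _ _), fun p => ?_⟩
  have h2 := hX.norm_smul_fderiv_le hτ p.1
  have h3 := hJ d (τ • fderiv ℝ X p.1) p.2 (h2.trans (h1.trans (min_le_left _ _)))
  have e : p.2.1 * τ • fderiv ℝ X p.1 = τ • (p.2.1 * fderiv ℝ X p.1) := by
    ext1 v; simp
  rw [e, map_smul, smul_eq_mul] at h3
  exact h3.trans (by gcongr)

lemma exists_moveJac_mul_sub_le {g : E n × Gr d n → ℝ} (hg : Continuous g) (R B : ℝ) {η : ℝ}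
    (hη : 0 < η) :
    ∃ τ₀ > 0, ∀ X : E n → E n, C1Bound X B → ∀ τ, 0 ≤ τ → τ ≤ τ₀ → τ * B ≤ 1 / 2 ∧
      ∀ p : E n × Gr d n, ‖p.1‖ ≤ R → |moveJac X τ p * g (moveMap X τ p) - g p| ≤ η := by
  obtain ⟨τ₁, hτ₁, hJ⟩ := exists_moveJac_expansion d n B zero_lt_one
  obtain ⟨G, hG⟩ := (isCompact_cylinder (d := d) (n := n) (R + 1)).exists_bound_of_continuousOn
    hg.continuousOn
  have huc := (isCompact_cylinder (d := d) (n := n) (R + 1)).uniformContinuousOn_of_continuous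
    hg.continuousOn
  obtain ⟨δ, hδ, hδ'⟩ := Metric.uniformContinuousOn_iff_le.1 huc (η / 2) (by positivity)
  set T := ‖traceCLM n‖ with hT
  have hT0 : 0 ≤ T := norm_nonneg (traceCLM n)
  -- The second bound brings the displacement `4 τ B` below `δ`, so that `g` moves by at most `η /
  -- 2`. The third makes the contribution `(1 + T) τ B |G|` of the Jacobian at most `η / 2`.
  refine ⟨min τ₁ (min (δ / (4 * (|B| + 1))) (η / (2 * ((1 + T) * |B| * |G| + 1)))),
    by positivity, fun X hX τ hτ hτ₀ => ?_⟩
  obtain ⟨hτB, hJ'⟩ := hJ X hX τ hτ (hτ₀.trans (min_le_left _ _))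
  refine ⟨hτB, fun p hp => ?_⟩
  have hB := hX.nonneg
  have h2 := hτ₀.trans ((min_le_right _ _).trans (min_le_left _ _))
  have h3 := hτ₀.trans ((min_le_right _ _).trans (min_le_right _ _))
  rw [le_div_iff₀ (by positivity), abs_of_nonneg hB] at h2 h3
  have hpm : p ∈ cylinder d n (R + 1) := mem_cylinder.2 (by linarith)
  have hqm : moveMap X τ p ∈ cylinder d n (R + 1) := by
    refine mem_cylinder.2 ((norm_add_le _ _).trans (add_le_add hp ?_))
    rw [norm_smul, Real.norm_eq_abs, abs_of_nonneg hτ]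
    have := mul_le_mul_of_nonneg_left (hX.norm_le p.1) hτ
    linarith
  have e1 : |g (moveMap X τ p) - g p| ≤ η / 2 := by
    refine hδ' _ hqm _ hpm ((hX.dist_moveMap_le hτ hτB p).trans ?_)
    linarith
  have e2 : |moveJac X τ p - 1| ≤ (1 + T) * (τ * B) := by
    have a1 := hJ' p
    have a2 : |τ * tangentialDiv X p.1 p.2| ≤ T * (τ * B) := by
      rw [abs_mul, abs_of_nonneg hτ]
      have := mul_le_mul_of_nonneg_left (abs_tangentialDiv_le hX p.1 p.2) hτ
      linarith
    calc |moveJac X τ p - 1| =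
        |(moveJac X τ p - 1 - τ * tangentialDiv X p.1 p.2) + τ * tangentialDiv X p.1 p.2| := by
          congr 1; ring
      _ ≤ _ := abs_add_le _ _
      _ ≤ _ := by linarith
  have e3 : |g (moveMap X τ p)| ≤ |G| := (hG _ hqm).trans (le_abs_self _)
  calc |moveJac X τ p * g (moveMap X τ p) - g p| =
      |(moveJac X τ p - 1) * g (moveMap X τ p) + (g (moveMap X τ p) - g p)| := by congr 1; ring
    _ ≤ |moveJac X τ p - 1| * |g (moveMap X τ p)| + |g (moveMap X τ p) - g p| := by
        rw [← abs_mul]; exact abs_add_le _ _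
    _ ≤ (1 + T) * (τ * B) * |G| + η / 2 := by gcongr
    _ ≤ η := by linarith

/-- With `a`, `b` the new and old values of `φ`, `A` its derivative along `(1, X)`, `J` the Jacobian
and `D'` the divergence, the error is `(J - 1 - τ D') a + (a - b - τ A) + τ D' (a - b)`. The first
two terms are Taylor remainders and the third is of second order in `τ`; each is kept below `η τ /
3`. -/
lemma IsTest.exists_moveJac_mul_expansion {φ : ℝ → E n → ℝ} (hφ : IsTest φ) (d : ℕ) (R B : ℝ)
    {η : ℝ} (hη : 0 < η) :
    ∃ τ₀ > 0, ∀ X : E n → E n, C1Bound X B → ∀ τ, 0 ≤ τ → τ ≤ τ₀ → τ * B ≤ 1 / 2 ∧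
      ∀ t, 0 ≤ t → t + τ ≤ 1 → ∀ p : E n × Gr d n, ‖p.1‖ ≤ R →
        |moveJac X τ p * φ (t + τ) (moveMap X τ p).1 - φ t p.1 -
          τ * (spaceTimeDeriv φ (t, p.1) (1, X p.1) + φ t p.1 * tangentialDiv X p.1 p.2)|
            ≤ η * τ := by
  obtain ⟨G, hG⟩ := (isCompact_slab (n := n) (R + 1)).exists_bound_of_continuousOn
    (hφ.continuousOn.mono (prod_mono le_rfl (subset_univ _)))
  obtain ⟨D, hD⟩ := (isCompact_slab (n := n) R).exists_bound_of_continuousOn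
    (hφ.continuousOn_spaceTimeDeriv.mono (prod_mono le_rfl (subset_univ _)))
  set T := ‖traceCLM n‖ with hT
  have hT0 : 0 ≤ T := norm_nonneg (traceCLM n)
  obtain ⟨τ₁, hτ₁, hJ⟩ := exists_moveJac_expansion d n B
    (δ := η / (3 * (|B| * |G| + 1))) (by positivity)
  obtain ⟨τ₂, hτ₂, hE⟩ := hφ.exists_expansion R (abs_nonneg B) (η := η / 3) (by positivity)
  -- `Q` is the constant for which the second-order term is at most `τ² Q`; the last threshold then
  -- gives `τ Q ≤ η / 3`.
  set Q := T * |B| * (η / 3 + |D| * (1 + |B|)) with hQ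
  have hQ0 : 0 ≤ Q := by positivity
  refine ⟨min τ₁ (min τ₂ (η / (3 * (Q + 1)))),
    by positivity, fun X hX τ hτ hτ₀ => ?_⟩
  obtain ⟨hτB, hJ'⟩ := hJ X hX τ hτ (hτ₀.trans (min_le_left _ _))
  refine ⟨hτB, fun t ht ht1 p hp => ?_⟩
  have hB := hX.nonneg
  have hBa := abs_of_nonneg hB
  have h2 := hτ₀.trans ((min_le_right _ _).trans (min_le_left _ _))
  have h3 := hτ₀.trans ((min_le_right _ _).trans (min_le_right _ _))
  rw [le_div_iff₀ (by positivity)] at h3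
  rw [hBa] at hQ
  set a := φ (t + τ) (moveMap X τ p).1 with ha
  set b := φ t p.1 with hb
  set A := spaceTimeDeriv φ (t, p.1) (1, X p.1) with hA
  set J := moveJac X τ p with hJd
  set D' := tangentialDiv X p.1 p.2 with hD'
  have hmv : ‖(moveMap X τ p).1‖ ≤ R + 1 := by
    refine (norm_add_le _ _).trans (add_le_add hp ?_)
    rw [norm_smul, Real.norm_eq_abs, abs_of_nonneg hτ]
    have := mul_le_mul_of_nonneg_left (hX.norm_le p.1) hτ
    linarith
  have e0 : |a| ≤ |G| := by
    refine le_trans (hG (t + τ, (moveMap X τ p).1) ⟨⟨by linarith, ht1⟩, ?_⟩) (le_abs_self _)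
    simpa using hmv
  have e1 : |a - b - τ * A| ≤ η / 3 * τ :=
    hE t τ ht hτ ht1 h2 p.1 (X p.1) hp ((hX.norm_le _).trans (le_abs_self _))
  have e2 : |J - 1 - τ * D'| ≤ η / (3 * (|B| * |G| + 1)) * (τ * B) := hJ' p
  have e3 : |A| ≤ |D| * (1 + B) := by
    refine ((spaceTimeDeriv φ (t, p.1)).le_opNorm (1, X p.1)).trans ?_
    gcongr
    · refine (hD (t, p.1) ⟨⟨ht, by linarith⟩, ?_⟩).trans (le_abs_self _)
      simpa using hp
    · rw [Prod.norm_def]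
      have := hX.norm_le p.1
      simp only [norm_one]
      exact max_le (by linarith) (by linarith)
  have e4 : |D'| ≤ T * B := abs_tangentialDiv_le hX p.1 p.2
  have e5 : |a - b| ≤ τ * (η / 3 + |D| * (1 + B)) := by
    have : |τ * A| ≤ τ * (|D| * (1 + B)) := by
      rw [abs_mul, abs_of_nonneg hτ]; gcongr
    calc |a - b| = |(a - b - τ * A) + τ * A| := by congr 1; ring
      _ ≤ |a - b - τ * A| + |τ * A| := abs_add_le _ _
      _ ≤ _ := by linarith
  have f1 : |(J - 1 - τ * D') * a| ≤ η / 3 * τ := by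
    rw [abs_mul]
    calc |J - 1 - τ * D'| * |a| ≤ η / (3 * (|B| * |G| + 1)) * (τ * B) * |G| := by gcongr
      _ = η / 3 * τ * ((|B| * |G|) / (|B| * |G| + 1)) := by
          rw [hBa]; field_simp
      _ ≤ η / 3 * τ * 1 := by
          gcongr
          rw [div_le_one (by positivity)]
          linarith
      _ = η / 3 * τ := mul_one _
  have f2 : |τ * D' * (a - b)| ≤ η / 3 * τ := by
    rw [abs_mul, abs_mul, abs_of_nonneg hτ]
    calc τ * |D'| * |a - b| ≤ τ * (T * B) * (τ * (η / 3 + |D| * (1 + B))) := by gcongr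
      _ = τ * (τ * Q) := by rw [hQ]; ring
      _ ≤ τ * (η / 3) := by gcongr; linarith
      _ = η / 3 * τ := mul_comm _ _
  calc |J * a - b - τ * (A + b * D')| =
      |(J - 1 - τ * D') * a + (a - b - τ * A) + τ * D' * (a - b)| := by congr 1; ring
    _ ≤ |(J - 1 - τ * D') * a| + |a - b - τ * A| + |τ * D' * (a - b)| := abs_add_three _ _ _
    _ ≤ η * τ := by linarith

/-- Finite varifolds of mass at most `M`, supported in the ball of radius `R`. -/
structure MassSuppBound (V : VMeasure d n) (M R : ℝ) : Prop where
  finite : IsFiniteMeasure V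
  mass_le : V.real univ ≤ M
  supp : SuppIn V R

lemma MassSuppBound.abs_integral_le {V : VMeasure d n} {M R : ℝ} (hV : MassSuppBound V M R)
    {g : E n × Gr d n → ℝ} {C : ℝ} (hC : 0 ≤ C) (hg : ∀ p, ‖p.1‖ ≤ R → |g p| ≤ C) :
    |∫ p, g p ∂V| ≤ C * M := by
  have := hV.finite
  refine (norm_integral_le_of_norm_le_const (C := C) (f := g)
    (Filter.Eventually.mono hV.supp fun p hp => hg p hp)).trans ?_
  exact mul_le_mul_of_nonneg_left hV.mass_le hC

lemma MassSuppBound.nonneg {V : VMeasure d n} {M R : ℝ} (hV : MassSuppBound V M R) : 0 ≤ M :=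
  measureReal_nonneg.trans hV.mass_le

lemma MassSuppBound.mono {V : VMeasure d n} {M M' R R' : ℝ} (hV : MassSuppBound V M R)
    (hM : M ≤ M') (hR : R ≤ R') : MassSuppBound V M' R' :=
  ⟨hV.finite, hV.mass_le.trans hM, hV.supp.mono hR⟩

/-- The threshold does not depend on `V` or `X`, so the estimate applies to varifolds that change
with the subdivision; it identifies the limits of the flow and of its nodes. -/
lemma exists_abs_integral_pushForward_sub_le {g : E n × Gr d n → ℝ} (hg : Continuous g)
    (M R B : ℝ) {η : ℝ} (hη : 0 < η) :
    ∃ τ₀ > 0, ∀ (V : VMeasure d n) (X : E n → E n), MassSuppBound V M R → C1Bound X B →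
      ∀ τ : ℝ, 0 ≤ τ → τ ≤ τ₀ →
        |∫ p, g p ∂(pushForward (fun x => x + τ • X x) V) - ∫ p, g p ∂V| ≤ η := by
  obtain ⟨τ₀, hτ₀, h⟩ := exists_moveJac_mul_sub_le hg R B (η := η / (|M| + 1)) (by positivity)
  refine ⟨τ₀, hτ₀, fun V X hV hX τ hτ hle => ?_⟩
  obtain ⟨hτB, h'⟩ := h X hX τ hτ hle
  have := hV.finite
  rw [hX.integral_pushForward hτ hτB V hg, ← integral_sub]
  · refine (hV.abs_integral_le (C := η / (|M| + 1)) (by positivity) h').trans ?_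
    rw [abs_of_nonneg hV.nonneg, div_mul_eq_mul_div, div_le_iff₀ (by linarith [hV.nonneg])]
    linarith
  · exact hV.supp.integrable ((hX.continuous_moveJac τ).mul
      (hg.comp (hX.continuous_moveMap hτ hτB)))
  · exact hV.supp.integrable hg

/-- The pointwise expansion is integrated against `V`, and the derivative along `(1, X)` splits into
`∂ₜφ + ∇φ · X`. Uniformity in `V`, `X` and `t` lets one threshold serve all nodes of all fine
subdivisions. -/
lemma IsTest.exists_pushForward_expansion {φ : ℝ → E n → ℝ} (hφ : IsTest φ) (d : ℕ) (M R B : ℝ)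
    {η : ℝ} (hη : 0 < η) :
    ∃ τ₀ > 0, ∀ (V : VMeasure d n) (X : E n → E n), MassSuppBound V M R → C1Bound X B →
      ∀ t τ : ℝ, 0 ≤ t → 0 ≤ τ → t + τ ≤ 1 → τ ≤ τ₀ →
        |∫ x, φ (t + τ) x ∂(mass (pushForward (fun x => x + τ • X x) V)) - ∫ x, φ t x ∂(mass V) -
          τ * (weightedFirstVariation V (φ t) X +
            ∫ x, derivWithin (fun s => φ s x) (Icc 0 1) t ∂(mass V))| ≤ η * τ := by
  obtain ⟨τ₀, hτ₀, h⟩ := hφ.exists_moveJac_mul_expansion d R B (η := η / (|M| + 1)) (by positivity)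
  refine ⟨τ₀, hτ₀, fun V X hV hX t τ ht hτ ht1 hle => ?_⟩
  obtain ⟨hτB, h'⟩ := h X hX τ hτ hle
  have := hV.finite
  have htm : t ∈ Icc (0 : ℝ) 1 := ⟨ht, by linarith⟩
  have htm' : t + τ ∈ Icc (0 : ℝ) 1 := ⟨by linarith, ht1⟩
  have hc := (hφ.contDiff htm).continuous
  have hc' := (hφ.contDiff htm').continuous
  have hgr := continuous_gradient (hφ.contDiff htm)
  have hXc := hX.contDiff.continuous
  have hdiv := continuous_tangentialDiv (d := d) hX.contDiff
  have hst : Continuous fun x => spaceTimeDeriv φ (t, x) := by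
    rw [← continuousOn_univ]
    exact hφ.continuousOn_spaceTimeDeriv.comp (by fun_prop) fun x _ => ⟨htm, mem_univ _⟩
  have hdt : (fun x => derivWithin (fun s => φ s x) (Icc 0 1) t) =
      fun x => spaceTimeDeriv φ (t, x) (1, 0) := funext fun x => hφ.derivWithin_eq htm x
  have hst1 : Continuous fun x => spaceTimeDeriv φ (t, x) (1, 0) := hst.clm_apply continuous_const
  rw [integral_mass hc', integral_mass hc, hdt, integral_mass hst1,
    hX.integral_pushForward hτ hτB V (g := fun p => φ (t + τ) p.1) (by fun_prop)]
  have i1 : Integrable (fun p : E n × Gr d n => moveJac X τ p * φ (t + τ) (moveMap X τ p).1) V :=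
    hV.supp.integrable ((hX.continuous_moveJac τ).mul
      (hc'.comp (hX.continuous_moveMap hτ hτB).fst))
  have i2 : Integrable (fun p : E n × Gr d n => φ t p.1) V := hV.supp.integrable (by fun_prop)
  have i3 : Integrable (fun p : E n × Gr d n => φ t p.1 * tangentialDiv X p.1 p.2) V :=
    hV.supp.integrable (by fun_prop)
  have i4 : Integrable (fun p : E n × Gr d n => ⟪gradient (φ t) p.1, X p.1⟫) V :=
    hV.supp.integrable (by fun_prop)
  have i5 : Integrable (fun p : E n × Gr d n => spaceTimeDeriv φ (t, p.1) (1, 0)) V :=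
    hV.supp.integrable (hst1.comp continuous_fst)
  unfold weightedFirstVariation
  have i34 : Integrable (fun p : E n × Gr d n =>
      φ t p.1 * tangentialDiv X p.1 p.2 + ⟪gradient (φ t) p.1, X p.1⟫) V := i3.add i4
  have i345 : Integrable (fun p : E n × Gr d n => τ * (φ t p.1 * tangentialDiv X p.1 p.2 +
      ⟪gradient (φ t) p.1, X p.1⟫ + spaceTimeDeriv φ (t, p.1) (1, 0))) V :=
    (i34.add i5).const_mul τ
  have i12 : Integrable (fun p : E n × Gr d n =>
      moveJac X τ p * φ (t + τ) (moveMap X τ p).1 - φ t p.1) V := i1.sub i2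
  rw [← integral_add i3 i4, ← integral_add i34 i5, ← integral_sub i1 i2,
    ← integral_const_mul, ← integral_sub i12 i345]
  refine (hV.abs_integral_le (C := η / (|M| + 1) * τ) (by positivity) fun p hp => ?_).trans ?_
  · have e := h' t ht ht1 p hp
    have e2 : spaceTimeDeriv φ (t, p.1) (1, X p.1) =
        ⟪gradient (φ t) p.1, X p.1⟫ + spaceTimeDeriv φ (t, p.1) (1, 0) := by
      rw [hφ.inner_gradient htm, ← map_add]
      simp
    rw [e2] at e
    convert e using 3
    ring
  · rw [abs_of_nonneg hV.nonneg]
    have : 0 < M + 1 := by linarith [hV.nonneg]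
    calc η / (M + 1) * τ * M = η * τ * (M / (M + 1)) := by field_simp
      _ ≤ η * τ * 1 := by
          gcongr
          rw [div_le_one this]; linarith
      _ = η * τ := mul_one _

/-! ### Integrals of step functions -/

lemma measurable_comp_floor (g : ℕ → ℝ) (N : ℝ) : Measurable fun r : ℝ => g ⌊r * N⌋₊ :=
  (measurable_from_top (f := g)).comp (Nat.measurable_floor.comp (measurable_id.mul_const N))

lemma intervalIntegrable_comp_floor (g : ℕ → ℝ) {N : ℝ} (hN : 0 < N) {a b : ℝ} (hab : a ≤ b) :
    IntervalIntegrable (fun r : ℝ => g ⌊r * N⌋₊) volume a b := by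
  rw [intervalIntegrable_iff_integrableOn_Icc_of_le hab]
  refine Measure.integrableOn_of_bounded (M := ∑ i ∈ Finset.range (⌊b * N⌋₊ + 1), |g i|)
    measure_Icc_lt_top.ne (measurable_comp_floor g N).aestronglyMeasurable ?_
  refine (ae_restrict_mem measurableSet_Icc).mono fun r hr => ?_
  rw [Real.norm_eq_abs]
  refine Finset.single_le_sum (f := fun i => |g i|) (fun i _ => abs_nonneg _) ?_
  rw [Finset.mem_range, Nat.lt_succ_iff]
  exact Nat.floor_mono (mul_le_mul_of_nonneg_right hr.2 hN.le)

lemma integral_comp_floor_step (g : ℕ → ℝ) {N : ℝ} (hN : 0 < N) (k : ℕ) {t : ℝ}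
    (h1 : k / N ≤ t) (h2 : t ≤ (k + 1) / N) :
    ∫ r in (k / N)..t, g ⌊r * N⌋₊ = (t - k / N) * g k := by
  have h : ∀ᵐ r : ℝ, r ∈ uIoc (k / N) t → g ⌊r * N⌋₊ = g k := by
    -- When `t` is the next node, the floor at `r = t` is already `k + 1`; this single point is
    -- discarded.
    have hne : ∀ᵐ r : ℝ, r ≠ t := by simp [ae_iff]
    filter_upwards [hne] with r hr hmem
    rw [uIoc_of_le h1] at hmem
    congr 1
    rw [Nat.floor_eq_iff (by have := hmem.1; have : 0 ≤ (k : ℝ) / N := by positivity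
                             have : 0 < r := by linarith
                             positivity)]
    constructor
    · have := hmem.1
      rw [div_lt_iff₀ hN] at this
      exact this.le
    · have : r < (k + 1) / N := (lt_of_le_of_ne hmem.2 hr).trans_le h2
      rwa [lt_div_iff₀ hN] at this
  rw [intervalIntegral.integral_congr_ae h, intervalIntegral.integral_const, smul_eq_mul]

/-- Telescoping: the sum of the `g i / N` is the integral of a step function, and the `k` errors `η
/ N` add up. The integral form is the one to which dominated convergence applies. -/
lemma abs_sub_integral_comp_floor_le {f g : ℕ → ℝ} {N η : ℝ} (hN : 0 < N) {K : ℕ}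
    (h : ∀ i < K, |f (i + 1) - f i - g i / N| ≤ η / N) :
    ∀ k ≤ K, |f k - f 0 - ∫ r in (0 : ℝ)..(k / N), g ⌊r * N⌋₊| ≤ η * (k / N) := by
  intro k
  induction k with
  | zero => intro _; simp
  | succ k ih =>
    intro hk
    have h1 := ih (by omega)
    have h2 := h k (by omega)
    have hkN : (k : ℝ) / N ≤ (k + 1) / N := by gcongr; linarith
    have hsplit : ∫ r in (0 : ℝ)..((k + 1 : ℕ) / N), g ⌊r * N⌋₊ =
        (∫ r in (0 : ℝ)..(k / N), g ⌊r * N⌋₊) + g k / N := by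
      push_cast
      rw [← intervalIntegral.integral_add_adjacent_intervals
        (intervalIntegrable_comp_floor g hN (by positivity : (0 : ℝ) ≤ k / N))
        (intervalIntegrable_comp_floor g hN hkN),
        integral_comp_floor_step g hN k hkN le_rfl]
      ring
    rw [hsplit]
    have e : η * ((k + 1 : ℕ) / N) = η * (k / N) + η / N := by push_cast; ring
    rw [e]
    calc _ = |(f k - f 0 - ∫ r in (0 : ℝ)..(k / N), g ⌊r * N⌋₊) +
          (f (k + 1) - f k - g k / N)| := by congr 1; ring
      _ ≤ _ := abs_add_le _ _
      _ ≤ _ := add_le_add h1 h2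

/-! ### Bounds for the time-discrete flow -/

section Flow

variable {ψ : E n → ℝ} {ε : ℝ}

lemma isTest_const (c : ℝ) : IsTest (fun (_ : ℝ) (_ : E n) => c) := contDiffOn_const

lemma exists_c1Bound (d : ℕ) (hψ : IsCutoff ψ) (hε : 0 < ε) (M : ℝ) :
    ∃ B : ℝ, 0 ≤ B ∧ ∀ (V : VMeasure d n) (R : ℝ), MassSuppBound V M R →
      C1Bound (approxCurvature ψ ε V) B := by
  obtain ⟨C, hC, h⟩ := exists_approxCurvature_bound d hψ hε
  refine ⟨C * |M|, by positivity, fun V R hV => ?_⟩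
  have := hV.finite
  have hle : C * V.real univ ≤ C * |M| :=
    mul_le_mul_of_nonneg_left (hV.mass_le.trans (le_abs_self M)) hC.le
  exact ⟨contDiff_approxCurvature hψ hε V, by positivity, fun x => (h V x).1.trans hle,
    fun x => (h V x).2.trans hle⟩

/-- One step of the flow increases the mass by at most `δ τ`, if `τ` is small. -/
lemma exists_massSuppBound_step (hψ : IsCutoff ψ) (hε : 0 < ε) {M B : ℝ}
    (hB : ∀ (V : VMeasure d n) (R : ℝ), MassSuppBound V M R → C1Bound (approxCurvature ψ ε V) B)
    (R : ℝ) {δ : ℝ} (hδ : 0 < δ) :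
    ∃ τ₀ > 0, ∀ (V : VMeasure d n) (m r : ℝ), MassSuppBound V m r → m ≤ M → r ≤ R →
      ∀ τ : ℝ, 0 ≤ τ → τ ≤ τ₀ → MassSuppBound (step ψ ε τ V) (m + δ * τ) (r + τ * B) := by
  obtain ⟨τ₁, hτ₁, hJ⟩ := exists_moveJac_expansion d n B hδ
  -- Tested against the constant `1`, the expansion describes the mass itself: its rate of change is
  -- the nonpositive first variation, and only the error `δ τ` can increase it.
  obtain ⟨τ₂, hτ₂, hE⟩ := (isTest_const (n := n) 1).exists_pushForward_expansion d M R B hδ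
  refine ⟨min 1 (min τ₁ τ₂), by positivity, fun V m r hV hm hr τ hτ hle => ?_⟩
  have hV' := hV.mono hm hr
  have hX := hB V R hV'
  have := hV.finite
  obtain ⟨hτB, -⟩ := hJ _ hX τ hτ (hle.trans ((min_le_right _ _).trans (min_le_left _ _)))
  have hfin : IsFiniteMeasure (step ψ ε τ V) := hX.isFiniteMeasure_pushForward τ hV.supp
  refine ⟨hfin, ?_, hX.suppIn_pushForward hτ hτB hV.supp⟩
  have h := hE V _ hV' hX 0 τ le_rfl hτ (by linarith [hle.trans (min_le_left _ _)])
    (hle.trans ((min_le_right _ _).trans (min_le_right _ _)))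
  have hgrad : gradient (fun _ : E n => (1 : ℝ)) = fun _ => 0 := by
    funext x; simp [gradient]
  rw [integral_mass continuous_const, integral_mass continuous_const] at h
  simp only [weightedFirstVariation, hgrad, inner_zero_left, integral_zero, one_mul, add_zero,
    derivWithin_fun_const, Pi.zero_apply, integral_const, smul_eq_mul, mul_one] at h
  change |(step ψ ε τ V).real univ - _ - _| ≤ _ at h
  have hneg := hV.supp.firstVariation_nonpos hψ hε
  have h1 := (abs_le.1 h).2
  have h2 := mul_nonpos_of_nonneg_of_nonpos hτ hneg
  linarith [hV.mass_le]

lemma natCast_floor_div_le {N t : ℝ} (hN : 0 < N) (ht : 0 ≤ t) : (⌊t * N⌋₊ : ℝ) / N ≤ t := by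
  rw [div_le_iff₀ hN]
  exact Nat.floor_le (by positivity)

lemma sub_natCast_floor_div_le {N t : ℝ} (hN : 0 < N) : t - (⌊t * N⌋₊ : ℝ) / N ≤ 1 / N := by
  rw [sub_le_iff_le_add, ← add_div, le_div_iff₀ hN]
  linarith [Nat.lt_floor_add_one (t * N)]

lemma floor_mul_two_pow_le {t : ℝ} (ht : t ≤ 1) (j : ℕ) : ⌊t * 2 ^ j⌋₊ ≤ 2 ^ j := by
  refine Nat.floor_le_of_le ?_
  push_cast
  have : (0 : ℝ) < 2 ^ j := by positivity
  nlinarith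

/-- The nodes of the time-discrete flow for the dyadic subdivision. -/
noncomputable def dyadicNode (ψ : E n → ℝ) (ε : ℝ) (V₀ : VMeasure d n) (j i : ℕ) : VMeasure d n :=
  nodeFlow ψ ε V₀ (fun k => (k : ℝ) / 2 ^ j) i

lemma dyadicNode_succ (ψ : E n → ℝ) (ε : ℝ) (V₀ : VMeasure d n) (j i : ℕ) :
    dyadicNode ψ ε V₀ j (i + 1) = step ψ ε (1 / 2 ^ j) (dyadicNode ψ ε V₀ j i) := by
  have : ((i + 1 : ℕ) : ℝ) / 2 ^ j - (i : ℝ) / 2 ^ j = 1 / 2 ^ j := by push_cast; ring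
  simp only [dyadicNode, nodeFlow, this]

lemma dyadicFlow_eq (ψ : E n → ℝ) (ε : ℝ) (V₀ : VMeasure d n) (j : ℕ) (t : ℝ) :
    dyadicFlow ψ ε V₀ j t =
      step ψ ε (t - (⌊t * 2 ^ j⌋₊ : ℝ) / 2 ^ j) (dyadicNode ψ ε V₀ j ⌊t * 2 ^ j⌋₊) := rfl

lemma eventually_one_div_two_pow_le {τ₀ : ℝ} (hτ₀ : 0 < τ₀) :
    ∀ᶠ j : ℕ in atTop, (1 : ℝ) / 2 ^ j ≤ τ₀ := by
  have h : Tendsto (fun j : ℕ => (1 : ℝ) / 2 ^ j) atTop (𝓝 0) := by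
    simp only [one_div]
    exact tendsto_inv_atTop_zero.comp (tendsto_pow_atTop_atTop_of_one_lt
      (one_lt_two : (1 : ℝ) < 2))
  exact (h.eventually (gt_mem_nhds hτ₀)).mono fun j hj => le_of_lt hj

/-- Mass and support of the time-discrete flow are controlled uniformly for fine subdivisions. -/
lemma exists_flow_bound (hψ : IsCutoff ψ) (hε : 0 < ε) {V₀ : VMeasure d n} {M R₀ : ℝ}
    (hV₀ : MassSuppBound V₀ M R₀) :
    ∃ B R : ℝ, (∀ (V : VMeasure d n) (R : ℝ), MassSuppBound V (M + 1) R →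
        C1Bound (approxCurvature ψ ε V) B) ∧
      ∀ᶠ j : ℕ in atTop, (∀ i ≤ 2 ^ j, MassSuppBound (dyadicNode ψ ε V₀ j i) (M + 1) R) ∧
        ∀ t ∈ Icc (0 : ℝ) 1, MassSuppBound (dyadicFlow ψ ε V₀ j t) (M + 1) R := by
  -- `B` is fixed in advance from the bound `M + 1`. Mass then grows at rate at most `1` and the
  -- radius at rate at most `B`, so over unit time the induction never leaves the range where `B` is
  -- valid.
  obtain ⟨B, hB0, hB⟩ := exists_c1Bound d hψ hε (M + 1)
  obtain ⟨τ₀, hτ₀, hstep⟩ := exists_massSuppBound_step hψ hε hB (R₀ + B) zero_lt_one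
  refine ⟨B, R₀ + B, hB, ?_⟩
  filter_upwards [eventually_one_div_two_pow_le hτ₀] with j hj
  have hN : (0 : ℝ) < 2 ^ j := by positivity
  have hle : ∀ s : ℝ, s ≤ 1 → M + s ≤ M + 1 ∧ R₀ + s * B ≤ R₀ + B := fun s hs =>
    ⟨by linarith, by nlinarith⟩
  have hnode : ∀ i : ℕ, i ≤ 2 ^ j →
      MassSuppBound (dyadicNode ψ ε V₀ j i) (M + i / 2 ^ j) (R₀ + i / 2 ^ j * B) := by
    intro i
    induction i with
    | zero => intro _; simpa [dyadicNode, nodeFlow] using hV₀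
    | succ i ih =>
      intro hi
      have h1 := ih (by omega)
      have hi1 : (i : ℝ) / 2 ^ j ≤ 1 := by
        rw [div_le_one hN]; exact_mod_cast (by omega : i ≤ 2 ^ j)
      have h2 := hstep _ _ _ h1 (hle _ hi1).1 (hle _ hi1).2 (1 / 2 ^ j) (by positivity) hj
      rw [dyadicNode_succ]
      refine h2.mono (le_of_eq ?_) (le_of_eq ?_) <;> push_cast <;> ring
  have hnode1 : ∀ i : ℕ, i ≤ 2 ^ j → (i : ℝ) / 2 ^ j ≤ 1 := fun i hi => by
    rw [div_le_one hN]; exact_mod_cast hi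
  refine ⟨fun i hi => (hnode i hi).mono (hle _ (hnode1 i hi)).1 (hle _ (hnode1 i hi)).2,
    fun t ht => ?_⟩
  have hi := floor_mul_two_pow_le ht.2 j
  rw [dyadicFlow_eq]
  refine (hstep _ _ _ (hnode _ hi) (hle _ (hnode1 _ hi)).1 (hle _ (hnode1 _ hi)).2 _
    (sub_nonneg.2 (natCast_floor_div_le hN ht.1))
    ((sub_natCast_floor_div_le hN).trans hj)).mono ?_ ?_
  · linarith [ht.2]
  · have := mul_le_mul_of_nonneg_right ht.2 hB0
    linarith

/-- The rate of change of the integral of a test function along the flow. -/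
noncomputable def flowRate (ψ : E n → ℝ) (ε : ℝ) (φ : ℝ → E n → ℝ) (t : ℝ) (V : VMeasure d n) :
    ℝ :=
  weightedFirstVariation V (φ t) (approxCurvature ψ ε V) +
    ∫ x, derivWithin (fun s => φ s x) (Icc 0 1) t ∂(mass V)

/-- The approximate integral identity along the time-discrete flow. -/
lemma IsTest.eventually_abs_dyadicFlow_sub_le {φ : ℝ → E n → ℝ} (hφ : IsTest φ)
    {V₀ : VMeasure d n} {M R B : ℝ}
    (hB : ∀ (V : VMeasure d n) (R : ℝ), MassSuppBound V M R → C1Bound (approxCurvature ψ ε V) B)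
    (hbd : ∀ᶠ j : ℕ in atTop, ∀ i ≤ 2 ^ j, MassSuppBound (dyadicNode ψ ε V₀ j i) M R)
    {η : ℝ} (hη : 0 < η) :
    ∀ᶠ j : ℕ in atTop, ∀ t ∈ Icc (0 : ℝ) 1,
      |∫ x, φ t x ∂(mass (dyadicFlow ψ ε V₀ j t)) - ∫ x, φ 0 x ∂(mass V₀) -
        ∫ r in (0 : ℝ)..t, flowRate ψ ε φ ((⌊r * 2 ^ j⌋₊ : ℝ) / 2 ^ j)
          (dyadicNode ψ ε V₀ j ⌊r * 2 ^ j⌋₊)| ≤ η := by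
  obtain ⟨τ₀, hτ₀, hE⟩ := hφ.exists_pushForward_expansion d M R B hη
  filter_upwards [hbd, eventually_one_div_two_pow_le hτ₀] with j hnode hj t ht
  have hN : (0 : ℝ) < 2 ^ j := by positivity
  set f : ℕ → ℝ := fun i => ∫ x, φ ((i : ℝ) / 2 ^ j) x ∂(mass (dyadicNode ψ ε V₀ j i)) with hf
  set g : ℕ → ℝ := fun i => flowRate ψ ε φ ((i : ℝ) / 2 ^ j) (dyadicNode ψ ε V₀ j i) with hg
  have hfg : ∀ i < 2 ^ j, |f (i + 1) - f i - g i / 2 ^ j| ≤ η / 2 ^ j := by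
    intro i hi
    have hVi := hnode i hi.le
    have e : (i : ℝ) / 2 ^ j + 1 / 2 ^ j = ((i + 1 : ℕ) : ℝ) / 2 ^ j := by push_cast; ring
    have h := hE _ _ hVi (hB _ _ hVi) ((i : ℝ) / 2 ^ j) (1 / 2 ^ j) (by positivity)
      (by positivity) (by
        rw [e, div_le_one hN]; exact_mod_cast hi) hj
    rw [e] at h
    change |∫ x, φ _ x ∂(mass (step ψ ε (1 / 2 ^ j) (dyadicNode ψ ε V₀ j i))) - _ - _| ≤ _ at h
    rw [← dyadicNode_succ, one_div_mul_eq_div, mul_one_div] at h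
    exact h
  set k := ⌊t * 2 ^ j⌋₊ with hk
  have hk1 : k ≤ 2 ^ j := floor_mul_two_pow_le ht.2 j
  have hkt : (k : ℝ) / 2 ^ j ≤ t := natCast_floor_div_le hN ht.1
  have hkt' : t - (k : ℝ) / 2 ^ j ≤ 1 / 2 ^ j := sub_natCast_floor_div_le hN
  have h1 := abs_sub_integral_comp_floor_le hN hfg k hk1
  have hVk := hnode k hk1
  -- The incomplete last step from the node `k / 2 ^ j` to `t` obeys the same expansion; at `t = 1`
  -- its length is `0`.
  have h2 := hE _ _ hVk (hB _ _ hVk) ((k : ℝ) / 2 ^ j) (t - k / 2 ^ j) (by positivity)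
      (by linarith) (by linarith [ht.2]) (hkt'.trans hj)
  rw [add_sub_cancel] at h2
  change |∫ x, φ t x ∂(mass (dyadicFlow ψ ε V₀ j t)) - f k - (t - k / 2 ^ j) * g k| ≤ _ at h2
  have hf0 : f 0 = ∫ x, φ 0 x ∂(mass V₀) := by simp [hf, dyadicNode, nodeFlow]
  have hsplit : ∫ r in (0 : ℝ)..t, g ⌊r * 2 ^ j⌋₊ =
      (∫ r in (0 : ℝ)..(k / 2 ^ j), g ⌊r * 2 ^ j⌋₊) + (t - k / 2 ^ j) * g k := by
    rw [← intervalIntegral.integral_add_adjacent_intervals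
      (intervalIntegrable_comp_floor g hN (by positivity : (0 : ℝ) ≤ k / 2 ^ j))
      (intervalIntegrable_comp_floor g hN hkt),
      integral_comp_floor_step g hN k hkt (by rw [add_div]; linarith)]
  rw [← hf0]
  change |_ - _ - ∫ r in (0 : ℝ)..t, g ⌊r * 2 ^ j⌋₊| ≤ _
  rw [hsplit]
  calc _ = |(∫ x, φ t x ∂(mass (dyadicFlow ψ ε V₀ j t)) - f k - (t - k / 2 ^ j) * g k) +
        (f k - f 0 - ∫ r in (0 : ℝ)..(k / 2 ^ j), g ⌊r * 2 ^ j⌋₊)| := by congr 1; ring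
    _ ≤ _ := abs_add_le _ _
    _ ≤ η * (t - k / 2 ^ j) + η * (k / 2 ^ j) := add_le_add h2 h1
    _ = η * t := by ring
    _ ≤ η := by nlinarith [ht.2]

end Flow

/-! ### Weak convergence of uniformly bounded varifolds -/

/-- Convergence against all continuous functions. -/
def WeakConv (V : ℕ → VMeasure d n) (W : VMeasure d n) : Prop :=
  ∀ g : E n × Gr d n → ℝ, Continuous g → Tendsto (fun j => ∫ p, g p ∂(V j)) atTop (𝓝 (∫ p, g p ∂W))

lemma hasCompactSupport_of_cylinder {g : E n × Gr d n → ℝ} {R : ℝ}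
    (h : ∀ p, R < ‖p.1‖ → g p = 0) : HasCompactSupport g :=
  HasCompactSupport.intro (isCompact_cylinder R) fun p hp => h p (by
    rwa [mem_cylinder, not_le] at hp)

/-- The bumps `max 0 (min (‖x‖ - R) (k - ‖x‖))` are admissible tests vanishing on the ball of radius
`R`. Their integrals are eventually `0`, hence `0` in the limit, and together they are positive at
every point outside the ball. -/
lemma WeakStar.suppIn {V : ℕ → VMeasure d n} {W : VMeasure d n} {R : ℝ} (h : WeakStar V W)
    [IsFiniteMeasureOnCompacts W] (hV : ∀ᶠ j in atTop, SuppIn (V j) R) : SuppIn W R := by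
  have key : ∀ k : ℕ, ∀ᵐ p ∂W, max 0 (min (‖p.1‖ - R) (k - ‖p.1‖)) = 0 := by
    intro k
    set g : E n × Gr d n → ℝ := fun p => max 0 (min (‖p.1‖ - R) (k - ‖p.1‖)) with hg
    have hc : Continuous g := by fun_prop
    have hs : HasCompactSupport g := hasCompactSupport_of_cylinder (R := k) fun p hp => by
      simp only [hg]
      exact max_eq_left ((min_le_right _ _).trans (by linarith))
    have h0 : ∀ p, 0 ≤ g p := fun p => le_max_left _ _
    have hlim := h g hc hs h0
    have hz : ∀ᶠ j in atTop, ∫ p, g p ∂(V j) = 0 := by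
      filter_upwards [hV] with j hj
      refine integral_eq_zero_of_ae (Filter.Eventually.mono hj fun p hp => ?_)
      exact max_eq_left ((min_le_left _ _).trans (by linarith))
    have h1 : ∫ p, g p ∂W = 0 :=
      tendsto_nhds_unique (hlim.congr' hz) tendsto_const_nhds
    exact (integral_eq_zero_iff_of_nonneg h0 (hc.integrable_of_hasCompactSupport hs)).1 h1
  refine Filter.Eventually.mono (ae_all_iff.2 key) fun p hp => ?_
  by_contra hlt
  rw [not_le] at hlt
  obtain ⟨k, hk⟩ := exists_nat_gt ‖p.1‖
  have : 0 < min (‖p.1‖ - R) (k - ‖p.1‖) := lt_min (by linarith) (by linarith)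
  exact absurd (hp k) (lt_max_of_lt_right this).ne'

lemma SuppIn.isFiniteMeasure {W : VMeasure d n} [IsFiniteMeasureOnCompacts W] {R : ℝ}
    (h : SuppIn W R) : IsFiniteMeasure W := by
  have h2 : W.restrict (cylinder d n R) = W :=
    Measure.restrict_eq_self_of_ae_mem (Filter.Eventually.mono h fun p hp => mem_cylinder.2 hp)
  refine ⟨?_⟩
  rw [← h2, Measure.restrict_apply_univ]
  exact (isCompact_cylinder R).measure_lt_top

/-- Weak-* tests are nonnegative and compactly supported. A cut-off equal to `1` on the common ball
is invisible to all the measures involved, and `g` is split into positive and negative parts. -/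
lemma WeakStar.weakConv {V : ℕ → VMeasure d n} {W : VMeasure d n} {R : ℝ} (h : WeakStar V W)
    [IsFiniteMeasureOnCompacts W]
    (hV : ∀ᶠ j in atTop, IsFiniteMeasure (V j) ∧ SuppIn (V j) R) : WeakConv V W := by
  intro g hg
  have hW : SuppIn W R := h.suppIn (hV.mono fun j hj => hj.2)
  have := hW.isFiniteMeasure
  let χ : E n × Gr d n → ℝ := fun p => max 0 (min 1 (R + 1 - ‖p.1‖))
  have hχc : Continuous χ := by fun_prop
  have hχ1 : ∀ p, ‖p.1‖ ≤ R → χ p = 1 := fun p hp => by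
    simp only [χ]
    rw [min_eq_left (by linarith), max_eq_right zero_le_one]
  have hχ0 : ∀ p, R + 1 < ‖p.1‖ → χ p = 0 := fun p hp =>
    max_eq_left ((min_le_right _ _).trans (by linarith))
  have hχnn : ∀ p, 0 ≤ χ p := fun p => le_max_left _ _
  have hpart : ∀ u : E n × Gr d n → ℝ, Continuous u → (∀ p, 0 ≤ u p) →
      Tendsto (fun j => ∫ p, u p * χ p ∂(V j)) atTop (𝓝 (∫ p, u p * χ p ∂W)) := fun u hu hu0 =>
    h _ (hu.mul hχc) (hasCompactSupport_of_cylinder (R := R + 1) fun p hp => by rw [hχ0 p hp, mul_zero])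
      fun p => mul_nonneg (hu0 p) (hχnn p)
  have hsplit : ∀ U : VMeasure d n, IsFiniteMeasure U → SuppIn U R →
      ∫ p, g p ∂U = ∫ p, max (g p) 0 * χ p ∂U - ∫ p, max (-g p) 0 * χ p ∂U := by
    intro U hU hUR
    rw [← integral_sub (hUR.integrable (by fun_prop)) (hUR.integrable (by fun_prop))]
    refine integral_congr_ae (Filter.Eventually.mono hUR fun p hp => ?_)
    simp only [hχ1 p hp, mul_one]
    rcases le_total 0 (g p) with h0 | h0
    · rw [max_eq_left h0, max_eq_right (by linarith), sub_zero]
    · rw [max_eq_right h0, max_eq_left (by linarith)]; ring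
  rw [hsplit W this hW]
  refine ((hpart _ (by fun_prop) fun p => le_max_right _ _).sub
    (hpart _ (by fun_prop) fun p => le_max_right _ _)).congr' ?_
  filter_upwards [hV] with j hj
  exact (hsplit _ hj.1 hj.2).symm

lemma WeakConv.massSuppBound {V : ℕ → VMeasure d n} {W : VMeasure d n} {M R : ℝ}
    (h : WeakConv V W) (hW : SuppIn W R) [IsFiniteMeasure W]
    (hV : ∀ᶠ j in atTop, MassSuppBound (V j) M R) : MassSuppBound W M R := by
  refine ⟨inferInstance, ?_, hW⟩
  have h1 := h (fun _ => 1) continuous_const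
  simp only [integral_const, smul_eq_mul, mul_one] at h1
  exact le_of_tendsto h1 (hV.mono fun j hj => hj.mass_le)

lemma WeakStar.massSuppBound_and_weakConv {V : ℕ → VMeasure d n} {W : VMeasure d n} {M R : ℝ}
    (h : WeakStar V W) (hfin : IsFiniteMeasureOnCompacts W)
    (hV : ∀ᶠ j in atTop, MassSuppBound (V j) M R) : MassSuppBound W M R ∧ WeakConv V W := by
  have h1 := h.suppIn (hV.mono fun j hj => hj.supp)
  have h2 := h.weakConv (hV.mono fun j hj => ⟨hj.finite, hj.supp⟩)
  have := h1.isFiniteMeasure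
  exact ⟨h2.massSuppBound h1 hV, h2⟩

/-- Needed because the dyadic time at which `φ` is evaluated moves with `j`. By compactness of the
cylinder, `G (s j)` converges to `G z` uniformly there, and the masses are bounded. -/
lemma WeakConv.tendsto_integral_param {V : ℕ → VMeasure d n} {W : VMeasure d n} {M R : ℝ}
    (h : WeakConv V W) (hV : ∀ᶠ j in atTop, MassSuppBound (V j) M R)
    {Z : Type*} [TopologicalSpace Z] {G : Z → E n × Gr d n → ℝ} (hG : Continuous (Function.uncurry G))
    {s : ℕ → Z} {z : Z} (hs : Tendsto s atTop (𝓝 z)) :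
    Tendsto (fun j => ∫ p, G (s j) p ∂(V j)) atTop (𝓝 (∫ p, G z p ∂W)) := by
  have hGz : ∀ z, Continuous (G z) := fun z => hG.comp (by fun_prop : Continuous fun p => (z, p))
  have h1 := h (G z) (hGz z)
  have h2 : Tendsto (fun j => ∫ p, G (s j) p ∂(V j) - ∫ p, G z p ∂(V j)) atTop (𝓝 0) := by
    rw [Metric.tendsto_nhds]
    intro η hη
    obtain ⟨v, hv, hvG⟩ := (isCompact_cylinder (d := d) (n := n) R).mem_uniformity_of_prod
      (f := G) (s := univ) (q := z) hG.continuousOn (mem_univ _)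
      (Metric.dist_mem_uniformity (by positivity : 0 < η / (2 * (|M| + 1))))
    rw [nhdsWithin_univ] at hv
    filter_upwards [hs hv, hV] with j hj hVj
    have := hVj.finite
    rw [dist_zero_right, Real.norm_eq_abs, ← integral_sub (hVj.supp.integrable (hGz _))
      (hVj.supp.integrable (hGz _))]
    refine (hVj.abs_integral_le (C := η / (2 * (|M| + 1))) (by positivity) fun p hp => ?_).trans_lt ?_
    · exact le_of_lt (hvG _ hj p (mem_cylinder.2 hp))
    · have hM := hVj.nonneg
      rw [abs_of_nonneg hM, div_mul_eq_mul_div, div_lt_iff₀ (by linarith)]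
      nlinarith
  have := h2.add h1
  simpa using this

lemma WeakConv.tendsto_integral_param_vector {V : ℕ → VMeasure d n} {W : VMeasure d n} {M R : ℝ}
    (h : WeakConv V W) (hV : ∀ᶠ j in atTop, MassSuppBound (V j) M R) (hW : MassSuppBound W M R)
    {Z : Type*} [TopologicalSpace Z] {G : Z → E n × Gr d n → E n}
    (hG : Continuous (Function.uncurry G))
    {s : ℕ → Z} {z : Z} (hs : Tendsto s atTop (𝓝 z)) :
    Tendsto (fun j => ∫ p, G (s j) p ∂(V j)) atTop (𝓝 (∫ p, G z p ∂W)) := by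
  have hGz : ∀ z, Continuous (G z) := fun z => hG.comp (by fun_prop : Continuous fun p => (z, p))
  let b := stdOrthonormalBasis ℝ (E n)
  have hrep : ∀ U : VMeasure d n, MassSuppBound U M R → ∀ z,
      ∑ i, (∫ p, ⟪b i, G z p⟫ ∂U) • b i = ∫ p, G z p ∂U := by
    intro U hU z
    have := hU.finite
    rw [← b.sum_repr' (∫ p, G z p ∂U)]
    refine Finset.sum_congr rfl fun i _ => ?_
    rw [integral_inner (hU.supp.integrable (hGz z))]
  rw [← hrep W hW z]
  refine (tendsto_finsetSum _ fun i _ => (h.tendsto_integral_param hV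
    (G := fun z p => ⟪b i, G z p⟫) ?_ hs).smul_const (b i)).congr' ?_
  · exact continuous_const.inner hG
  · filter_upwards [hV] with j hj
    exact hrep _ hj _

section Flow

variable {ψ : E n → ℝ} {ε : ℝ}

lemma WeakConv.tendsto_preCurvature (hψ : IsCutoff ψ) (hε : 0 < ε)
    {V : ℕ → VMeasure d n} {W : VMeasure d n} {M R : ℝ}
    (h : WeakConv V W) (hV : ∀ᶠ j in atTop, MassSuppBound (V j) M R) (hW : MassSuppBound W M R)
    (y : E n) :
    Tendsto (fun j => preCurvature ψ ε (V j) y) atTop (𝓝 (preCurvature ψ ε W y)) := by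
  have hk := continuous_kernel hψ ε
  have hgk := continuous_apply_gradient_kernel (d := d) hψ ε
  have h1 : Tendsto (fun j => massConv ψ ε (V j) y) atTop (𝓝 (massConv ψ ε W y)) := by
    simp only [massConv_eq hψ]
    exact h _ (by fun_prop)
  have h2 : Tendsto (fun j => firstVariationConv ψ ε (V j) y) atTop
      (𝓝 (firstVariationConv ψ ε W y)) :=
    h.tendsto_integral_param_vector hV hW (Z := Unit) (s := fun _ => ()) (z := ())
      (G := fun _ p => p.2.1 (gradient (kernel ψ ε) (p.1 - y)))
      (hgk.comp (by fun_prop : Continuous fun q : Unit × E n × Gr d n => (q.2, y)))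
      tendsto_const_nhds
  unfold preCurvature
  refine (((h1.add_const ε).inv₀ ?_).smul h2).neg
  exact (add_pos_of_nonneg_of_pos (massConv_nonneg hψ W y) hε).ne'

variable {φ : ℝ → E n → ℝ}

/-- Time is taken in the subtype because `φ` is controlled only on `[0, 1]`; the subtype then serves
as the parameter space in `WeakConv.tendsto_integral_param`. -/
lemma IsTest.continuous_subtype (hφ : IsTest φ) :
    Continuous fun q : Icc (0 : ℝ) 1 × E n => φ q.1 q.2 :=
  hφ.continuousOn.comp_continuous (f := fun q : Icc (0 : ℝ) 1 × E n => ((q.1 : ℝ), q.2))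
    (by fun_prop) fun q => ⟨q.1.2, mem_univ _⟩

lemma IsTest.continuous_spaceTimeDeriv_subtype (hφ : IsTest φ) :
    Continuous fun q : Icc (0 : ℝ) 1 × E n => spaceTimeDeriv φ (q.1, q.2) :=
  hφ.continuousOn_spaceTimeDeriv.comp_continuous
    (f := fun q : Icc (0 : ℝ) 1 × E n => ((q.1 : ℝ), q.2))
    (by fun_prop) fun q => ⟨q.1.2, mem_univ _⟩

lemma IsTest.continuous_derivWithin_subtype (hφ : IsTest φ) :
    Continuous fun q : Icc (0 : ℝ) 1 × E n =>
      derivWithin (fun s => φ s q.2) (Icc 0 1) (q.1 : ℝ) := by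
  have h : (fun q : Icc (0 : ℝ) 1 × E n => derivWithin (fun s => φ s q.2) (Icc 0 1) (q.1 : ℝ)) =
      fun q => spaceTimeDeriv φ (q.1, q.2) (1, 0) :=
    funext fun q => hφ.derivWithin_eq q.1.2 q.2
  rw [h]
  exact hφ.continuous_spaceTimeDeriv_subtype.clm_apply continuous_const

lemma IsTest.continuous_gradient_subtype (hφ : IsTest φ) :
    Continuous fun q : Icc (0 : ℝ) 1 × E n => gradient (φ q.1) q.2 := by
  let b := stdOrthonormalBasis ℝ (E n)
  have h : (fun q : Icc (0 : ℝ) 1 × E n => gradient (φ q.1) q.2) =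
      fun q => ∑ i, spaceTimeDeriv φ (q.1, q.2) (0, b i) • b i := by
    funext q
    rw [← b.sum_repr' (gradient (φ q.1) q.2)]
    refine Finset.sum_congr rfl fun i _ => ?_
    rw [real_inner_comm, hφ.inner_gradient q.1.2]
  rw [h]
  exact continuous_finsetSum _ fun i _ =>
    (hφ.continuous_spaceTimeDeriv_subtype.clm_apply continuous_const).smul continuous_const

lemma IsTest.tendsto_integral_derivWithin (hφ : IsTest φ)
    {V : ℕ → VMeasure d n} {W : VMeasure d n} {M R : ℝ}
    (h : WeakConv V W) (hV : ∀ᶠ j in atTop, MassSuppBound (V j) M R)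
    {s : ℕ → Icc (0 : ℝ) 1} {z : Icc (0 : ℝ) 1} (hs : Tendsto s atTop (𝓝 z)) :
    Tendsto (fun j => ∫ x, derivWithin (fun r => φ r x) (Icc 0 1) (s j : ℝ) ∂(mass (V j))) atTop
      (𝓝 (∫ x, derivWithin (fun r => φ r x) (Icc 0 1) (z : ℝ) ∂(mass W))) := by
  have hc := hφ.continuous_derivWithin_subtype
  have hcz : ∀ z : Icc (0 : ℝ) 1, Continuous fun x : E n =>
      derivWithin (fun r => φ r x) (Icc 0 1) (z : ℝ) := fun z =>
    hc.comp (by fun_prop : Continuous fun x : E n => (z, x))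
  simp only [fun (z : Icc (0 : ℝ) 1) (U : VMeasure d n) => integral_mass (V := U) (hcz z)]
  exact h.tendsto_integral_param hV
    (G := fun (z : Icc (0 : ℝ) 1) p => derivWithin (fun r => φ r p.1) (Icc 0 1) (z : ℝ))
    (hc.comp (by fun_prop : Continuous fun q : Icc (0 : ℝ) 1 × E n × Gr d n => (q.1, q.2.1))) hs

/-- Both the measure and the field `h_ε` vary. In the Fubini form the dependence on `V` becomes, for
each `y`, a pairing of the integral of a continuous kernel with `h̃_ε(y, V)`. Both converge, so no
convergence of `h_ε` in `C¹` is needed. -/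
lemma IsTest.tendsto_weightedFirstVariation (hφ : IsTest φ) (hψ : IsCutoff ψ) (hε : 0 < ε)
    {V : ℕ → VMeasure d n} {W : VMeasure d n} {M R : ℝ}
    (h : WeakConv V W) (hV : ∀ᶠ j in atTop, MassSuppBound (V j) M R) (hW : MassSuppBound W M R)
    {s : ℕ → Icc (0 : ℝ) 1} {z : Icc (0 : ℝ) 1} (hs : Tendsto s atTop (𝓝 z)) :
    Tendsto (fun j => weightedFirstVariation (V j) (φ (s j)) (approxCurvature ψ ε (V j))) atTop
      (𝓝 (weightedFirstVariation W (φ z) (approxCurvature ψ ε W))) := by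
  have hφc := hφ.continuous_subtype
  have hφg := hφ.continuous_gradient_subtype
  set w : Icc (0 : ℝ) 1 → E n × Gr d n → E n → E n := fun z p y =>
    weightedKernel ψ ε (φ z p.1) (gradient (φ z) p.1) p y with hw
  have hwc : Continuous fun q : Icc (0 : ℝ) 1 × (E n × Gr d n) × E n => w q.1 q.2.1 q.2.2 :=
    continuous_weightedKernel hψ ε
      (hφc.comp (by fun_prop : Continuous fun q : Icc (0 : ℝ) 1 × (E n × Gr d n) × E n =>
        (q.1, q.2.1.1)))
      (hφg.comp (by fun_prop : Continuous fun q : Icc (0 : ℝ) 1 × (E n × Gr d n) × E n =>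
        (q.1, q.2.1.1))) (by fun_prop) (by fun_prop)
  have hWf := hW.finite
  have hM := hW.nonneg
  have e : ∀ (U : VMeasure d n) (z : Icc (0 : ℝ) 1), MassSuppBound U M R →
      weightedFirstVariation U (φ z) (approxCurvature ψ ε U) =
        ∫ y, ⟪∫ p, w z p y ∂U, preCurvature ψ ε U y⟫ := fun U z hU => by
    have := hU.finite
    exact hU.supp.weightedFirstVariation_eq hψ hε (hφ.contDiff z.2)
  rw [e W z hW]
  obtain ⟨K, hK0, hK⟩ := exists_kernel_bound hψ ε
  obtain ⟨C, hC⟩ := ((isCompact_univ (X := Icc (0 : ℝ) 1)).prod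
    ((isCompact_cylinder (d := d) (n := n) R).prod
      (isCompact_closedBall (0 : E n) (R + 1)))).exists_bound_of_continuousOn hwc.continuousOn
  refine Tendsto.congr' (f₁ := fun j => ∫ y, ⟪∫ p, w (s j) p y ∂(V j), preCurvature ψ ε (V j) y⟫)
    (by filter_upwards [hV] with j hj; exact (e _ _ hj).symm) ?_
  -- The first factor is at most `|C| M` and `h̃_ε` at most `ε⁻¹ K M`; beyond radius `R + 1` the
  -- kernel does not reach the support of the varifolds.
  refine tendsto_integral_filter_of_dominated_convergence
    ((Metric.closedBall (0 : E n) (R + 1)).indicator fun _ => |C| * M * (ε⁻¹ * (K * M))) ?_ ?_ ?_ ?_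
  · filter_upwards [hV] with j hj
    have := hj.finite
    have hwy : Continuous fun q : (E n × Gr d n) × E n => w (s j) q.1 q.2 :=
      hwc.comp (by fun_prop : Continuous fun q : (E n × Gr d n) × E n => (s j, q.1, q.2))
    have hm : StronglyMeasurable fun y => ∫ p, w (s j) p y ∂(V j) :=
      StronglyMeasurable.integral_prod_right (f := fun y p => w (s j) p y)
        (hwy.comp continuous_swap).stronglyMeasurable
    exact (hm.aestronglyMeasurable).inner
      (continuous_preCurvature hψ hε (V j)).aestronglyMeasurable
  · filter_upwards [hV] with j hj
    have := hj.finite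
    refine Eventually.of_forall fun y => ?_
    by_cases hy : y ∈ Metric.closedBall (0 : E n) (R + 1)
    · rw [indicator_of_mem hy]
      refine (norm_inner_le_norm _ _).trans (mul_le_mul ?_ ?_ (norm_nonneg _) (by positivity))
      · refine (norm_integral_le_of_norm_le_const (C := |C|)
          (Filter.Eventually.mono hj.supp fun p hp => ?_)).trans
          (mul_le_mul_of_nonneg_left hj.mass_le (abs_nonneg C))
        exact (hC (s j, p, y) ⟨mem_univ _, mem_cylinder.2 hp, hy⟩).trans (le_abs_self C)
      · refine (norm_preCurvature_le hψ hε (fun x => (hK x).2) (V j) y).trans ?_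
        have := hj.mass_le
        gcongr
    · rw [indicator_of_notMem hy]
      rw [mem_closedBall_zero_iff, not_le] at hy
      have h0 : ∫ p, w (s j) p y ∂(V j) = 0 := by
        refine integral_eq_zero_of_ae (Filter.Eventually.mono hj.supp fun p hp => ?_)
        refine weightedKernel_eq_zero hψ ?_
        have : ‖y‖ ≤ ‖p.1‖ + ‖p.1 - y‖ := by
          calc ‖y‖ = ‖p.1 - (p.1 - y)‖ := by simp
            _ ≤ _ := norm_sub_le _ _
        linarith
      rw [h0, inner_zero_left, norm_zero]
  · exact (integrable_indicator_iff measurableSet_closedBall).2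
      (integrableOn_const measure_closedBall_lt_top.ne)
  · refine Eventually.of_forall fun y => ?_
    refine Tendsto.inner ?_ (h.tendsto_preCurvature hψ hε hV hW y)
    exact h.tendsto_integral_param_vector hV hW (G := fun z p => w z p y)
      (hwc.comp (by fun_prop : Continuous fun q : Icc (0 : ℝ) 1 × (E n × Gr d n) =>
        (q.1, q.2, y))) hs

/-- The nodes of the time-discrete flow preceding `t` have the same limit as the flow at `t`. -/
lemma WeakConv.dyadicNode {V₀ W : VMeasure d n} {M R B t : ℝ} (ht : t ∈ Icc (0 : ℝ) 1)
    (hB : ∀ (V : VMeasure d n) (R : ℝ), MassSuppBound V M R → C1Bound (approxCurvature ψ ε V) B)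
    (hbd : ∀ᶠ j : ℕ in atTop, ∀ i ≤ 2 ^ j, MassSuppBound (dyadicNode ψ ε V₀ j i) M R)
    (h : WeakConv (fun j => dyadicFlow ψ ε V₀ j t) W) :
    WeakConv (fun j => VarifoldFlow.dyadicNode ψ ε V₀ j ⌊t * 2 ^ j⌋₊) W := by
  intro g hg
  have h1 : Tendsto (fun j => ∫ p, g p ∂(dyadicFlow ψ ε V₀ j t) -
      ∫ p, g p ∂(VarifoldFlow.dyadicNode ψ ε V₀ j ⌊t * 2 ^ j⌋₊)) atTop (𝓝 0) := by
    rw [Metric.tendsto_nhds]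
    intro η hη
    obtain ⟨τ₀, hτ₀, hE⟩ := exists_abs_integral_pushForward_sub_le hg M R B
      (η := η / 2) (by positivity)
    filter_upwards [hbd, eventually_one_div_two_pow_le hτ₀] with j hnode hj
    have hN : (0 : ℝ) < 2 ^ j := by positivity
    have hV := hnode _ (floor_mul_two_pow_le ht.2 j)
    have := hE _ _ hV (hB _ _ hV) (t - (⌊t * 2 ^ j⌋₊ : ℝ) / 2 ^ j)
      (sub_nonneg.2 (natCast_floor_div_le hN ht.1)) ((sub_natCast_floor_div_le hN).trans hj)
    rw [dist_zero_right, Real.norm_eq_abs]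
    exact lt_of_le_of_lt this (by linarith)
  have h2 := (h g hg).sub h1
  simpa using h2

/-- The dyadic point preceding `t`. -/
noncomputable def dyadicTime (j : ℕ) (t : Icc (0 : ℝ) 1) : Icc (0 : ℝ) 1 :=
  ⟨(⌊(t : ℝ) * 2 ^ j⌋₊ : ℝ) / 2 ^ j, by positivity,
    (natCast_floor_div_le (by positivity) t.2.1).trans t.2.2⟩

lemma tendsto_dyadicTime (t : Icc (0 : ℝ) 1) :
    Tendsto (fun j => dyadicTime j t) atTop (𝓝 t) := by
  rw [Metric.tendsto_nhds]
  intro η hη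
  filter_upwards [eventually_one_div_two_pow_le (half_pos hη)] with j hj
  have hN : (0 : ℝ) < 2 ^ j := by positivity
  rw [Subtype.dist_eq, dist_comm, Real.dist_eq]
  change |(t : ℝ) - (⌊(t : ℝ) * 2 ^ j⌋₊ : ℝ) / 2 ^ j| < η
  rw [abs_of_nonneg (sub_nonneg.2 (natCast_floor_div_le hN t.2.1))]
  linarith [(sub_natCast_floor_div_le (t := (t : ℝ)) hN).trans hj]

/-- Supplies the constant dominating both rates in the time integrals, uniformly in the subdivision.
-/
lemma IsTest.exists_rate_bound (hφ : IsTest φ) (d : ℕ) (M R B : ℝ) :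
    ∃ C, ∀ (V : VMeasure d n) (X : E n → E n), MassSuppBound V M R → C1Bound X B →
      ∀ t ∈ Icc (0 : ℝ) 1, |weightedFirstVariation V (φ t) X| ≤ C ∧
        |∫ x, derivWithin (fun s => φ s x) (Icc 0 1) t ∂(mass V)| ≤ C := by
  obtain ⟨G, hG⟩ := (isCompact_slab (n := n) R).exists_bound_of_continuousOn
    (hφ.continuousOn.mono (prod_mono le_rfl (subset_univ _)))
  obtain ⟨D, hD⟩ := (isCompact_slab (n := n) R).exists_bound_of_continuousOn
    (hφ.continuousOn_spaceTimeDeriv.mono (prod_mono le_rfl (subset_univ _)))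
  set T := ‖traceCLM n‖ with hT
  have hT0 : 0 ≤ T := norm_nonneg (traceCLM n)
  refine ⟨(|G| * (T * |B|) + |D| * |B|) * |M| + |D| * |M|, fun V X hV hX t ht => ?_⟩
  have hmem : ∀ x : E n, ‖x‖ ≤ R → (t, x) ∈ Icc (0 : ℝ) 1 ×ˢ Metric.closedBall (0 : E n) R :=
    fun x hx => ⟨ht, by simpa using hx⟩
  have hM := hV.nonneg
  rw [abs_of_nonneg hM, abs_of_nonneg hX.nonneg]
  have hB := hX.nonneg
  have h1 : |∫ p, φ t p.1 * tangentialDiv X p.1 p.2 ∂V| ≤ |G| * (T * B) * M :=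
    hV.abs_integral_le (by positivity) fun p hp => by
      rw [abs_mul]
      exact mul_le_mul ((hG _ (hmem _ hp)).trans (le_abs_self G)) (abs_tangentialDiv_le hX _ _)
        (abs_nonneg _) (abs_nonneg _)
  have h2 : |∫ p, ⟪gradient (φ t) p.1, X p.1⟫ ∂V| ≤ |D| * B * M :=
    hV.abs_integral_le (by positivity) fun p hp => by
      rw [hφ.inner_gradient ht]
      refine ((spaceTimeDeriv φ (t, p.1)).le_opNorm _).trans ?_
      refine mul_le_mul ((hD _ (hmem _ hp)).trans (le_abs_self D)) ?_ (norm_nonneg _)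
        (abs_nonneg _)
      rw [Prod.norm_def]
      simpa using hX.norm_le p.1
  have h3 : |∫ x, derivWithin (fun s => φ s x) (Icc 0 1) t ∂(mass V)| ≤ |D| * M := by
    have hc : Continuous fun x : E n => derivWithin (fun s => φ s x) (Icc 0 1) t :=
      hφ.continuous_derivWithin_subtype.comp
        (by fun_prop : Continuous fun x : E n => ((⟨t, ht⟩ : Icc (0 : ℝ) 1), x))
    rw [integral_mass hc]
    refine hV.abs_integral_le (by positivity) fun p hp => ?_
    rw [hφ.derivWithin_eq ht]
    refine ((spaceTimeDeriv φ (t, p.1)).le_opNorm _).trans ?_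
    have : ‖((1 : ℝ), (0 : E n))‖ = 1 := by simp [Prod.norm_def]
    rw [this, mul_one]
    exact (hD _ (hmem _ hp)).trans (le_abs_self D)
  constructor
  · have := abs_add_le (∫ p, φ t p.1 * tangentialDiv X p.1 p.2 ∂V)
      (∫ p, ⟪gradient (φ t) p.1, X p.1⟫ ∂V)
    unfold weightedFirstVariation
    have h4 : 0 ≤ |D| * M := by positivity
    linarith
  · have h4 : 0 ≤ (|G| * (T * B) + |D| * B) * M := by positivity
    linarith

end Flow

/-! ### Limits of the time integrals and the Brakke-type equality -/

lemma exists_massSuppBound_of_isCompact_support {V : VMeasure d n} (hV : IsCompact V.support)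
    {M : ℝ} (hM : 0 ≤ M) (hVM : mass V univ ≤ ENNReal.ofReal M) :
    ∃ R, MassSuppBound V M R := by
  have hu : V univ ≤ ENNReal.ofReal M := by
    rwa [mass, Measure.map_apply measurable_fst MeasurableSet.univ, preimage_univ] at hVM
  obtain ⟨R, hR⟩ := (hV.image continuous_fst).isBounded.exists_norm_le
  refine ⟨R, ⟨hu.trans_lt ENNReal.ofReal_lt_top⟩, ENNReal.toReal_le_of_le_ofReal hM hu, ?_⟩
  have h : ∀ᵐ p ∂V, p ∈ V.support := Measure.measure_compl_support
  exact Filter.Eventually.mono h fun p hp => hR _ ⟨p, hp, rfl⟩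

/-- A uniformly bounded pointwise limit of measurable functions on `[0, 1]` is integrable, and the
integrals converge. -/
lemma intervalIntegrable_and_tendsto_of_bounded {f : ℕ → ℝ → ℝ} {g : ℝ → ℝ} {C : ℝ}
    (hf : ∀ j, Measurable (f j))
    (hC : ∀ᶠ j in atTop, ∀ t ∈ Icc (0 : ℝ) 1, |f j t| ≤ C)
    (hlim : ∀ t ∈ Icc (0 : ℝ) 1, Tendsto (fun j => f j t) atTop (𝓝 (g t)))
    {a b : ℝ} (ha : 0 ≤ a) (hab : a ≤ b) (hb : b ≤ 1) :
    IntervalIntegrable g volume a b ∧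
      Tendsto (fun j => ∫ t in a..b, f j t) atTop (𝓝 (∫ t in a..b, g t)) := by
  have hsub : Ioc a b ⊆ Icc (0 : ℝ) 1 := fun t ht => ⟨ha.trans ht.1.le, ht.2.trans hb⟩
  have hlim' : ∀ᵐ t ∂(volume.restrict (Ioc a b)), Tendsto (fun j => f j t) atTop (𝓝 (g t)) :=
    (ae_restrict_mem measurableSet_Ioc).mono fun t ht => hlim t (hsub ht)
  have hgm : AEStronglyMeasurable g (volume.restrict (Ioc a b)) :=
    aestronglyMeasurable_of_tendsto_ae atTop (fun j => (hf j).aestronglyMeasurable) hlim'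
  constructor
  · rw [intervalIntegrable_iff_integrableOn_Ioc_of_le hab]
    refine Integrable.of_bound hgm C ?_
    refine (ae_restrict_mem measurableSet_Ioc).mono fun t ht => ?_
    exact le_of_tendsto (hlim t (hsub ht)).norm (hC.mono fun j hj => hj t (hsub ht))
  · refine intervalIntegral.tendsto_integral_filter_of_dominated_convergence (fun _ => C)
      (Eventually.of_forall fun j => (hf j).aestronglyMeasurable) ?_ (by simp) ?_
    · filter_upwards [hC] with j hj
      refine Eventually.of_forall fun t ht => ?_
      rw [uIoc_of_le hab] at ht
      exact hj t (hsub ht)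
    · refine Eventually.of_forall fun t ht => ?_
      rw [uIoc_of_le hab] at ht
      exact hlim t (hsub ht)

end VarifoldFlow

theorem proposition4p5 (d n : ℕ) (hd : 1 ≤ d) (hdn : d ≤ n) (hn : 2 ≤ n)
    (ψ : E n → ℝ) (hψ : IsCutoff ψ)
    (ε : ℝ) (hε₀ : 0 < ε) (hε₁ : ε < 1) (M : ℝ) (hM : 1 ≤ M)
    (V₀ : VMeasure d n) (hV₀ : IsCompact V₀.support) (hV₀M : mass V₀ univ ≤ ENNReal.ofReal M)
    (V : ℝ → VMeasure d n) (hV : IsApproxMCF ψ ε V₀ V)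
    (φ : ℝ → E n → ℝ)
    (hφ : ContDiffOn ℝ 1 (fun p : ℝ × E n => φ p.1 p.2) (Icc (0 : ℝ) 1 ×ˢ univ))
    (hφ₀ : ∀ t ∈ Icc (0 : ℝ) 1, ∀ x, 0 ≤ φ t x)
    (a b : ℝ) (ha : 0 ≤ a) (hab : a ≤ b) (hb : b ≤ 1) :
    -- the integrals with respect to the varifolds converge absolutely
    (∀ t ∈ Icc (0 : ℝ) 1,
      Integrable (φ t) (mass (V t)) ∧
      Integrable (fun x => derivWithin (fun s => φ s x) (Icc 0 1) t) (mass (V t)) ∧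
      Integrable (fun p => φ t p.1 * tangentialDiv (approxCurvature ψ ε (V t)) p.1 p.2) (V t) ∧
      Integrable (fun p => ⟪gradient (φ t) p.1, approxCurvature ψ ε (V t) p.1⟫) (V t)) ∧
    -- and so do the time integrals
    IntervalIntegrable
      (fun t => weightedFirstVariation (V t) (φ t) (approxCurvature ψ ε (V t))) volume a b ∧
    IntervalIntegrable
      (fun t => ∫ x, derivWithin (fun s => φ s x) (Icc 0 1) t ∂(mass (V t))) volume a b ∧
    -- the Brakke-type equality
    (∫ x, φ b x ∂(mass (V b))) - (∫ x, φ a x ∂(mass (V a))) =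
      (∫ t in a..b, weightedFirstVariation (V t) (φ t) (approxCurvature ψ ε (V t))) +
        ∫ t in a..b, ∫ x, derivWithin (fun s => φ s x) (Icc 0 1) t ∂(mass (V t)) := by

  have hφ' : IsTest φ := hφ
  obtain ⟨R₀, hV₀b⟩ := exists_massSuppBound_of_isCompact_support hV₀ (by linarith) hV₀M
  obtain ⟨B, R, hB, hflow⟩ := exists_flow_bound hψ hε₀ hV₀b
  have hnode : ∀ᶠ j : ℕ in atTop, ∀ i ≤ 2 ^ j,
      MassSuppBound (dyadicNode ψ ε V₀ j i) (M + 1) R := hflow.mono fun j hj => hj.1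
  have hlim : ∀ t ∈ Icc (0 : ℝ) 1, MassSuppBound (V t) (M + 1) R ∧
      WeakConv (fun j => dyadicFlow ψ ε V₀ j t) (V t) := fun t ht =>
    (hV t ht).2.massSuppBound_and_weakConv (hV t ht).1 (hflow.mono fun j hj => hj.2 t ht)
  -- The discrete rates are evaluated at the nodes, so it is the nodes whose convergence to `V t` is
  -- required.
  have hlimN : ∀ t ∈ Icc (0 : ℝ) 1,
      WeakConv (fun j => dyadicNode ψ ε V₀ j ⌊t * 2 ^ j⌋₊) (V t) := fun t ht =>
    (hlim t ht).2.dyadicNode ht hB hnode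
  have hnodeF : ∀ t ∈ Icc (0 : ℝ) 1, ∀ᶠ j : ℕ in atTop,
      MassSuppBound (dyadicNode ψ ε V₀ j ⌊t * 2 ^ j⌋₊) (M + 1) R := fun t ht =>
    hnode.mono fun j hj => hj _ (floor_mul_two_pow_le ht.2 j)
  obtain ⟨C, hC⟩ := hφ'.exists_rate_bound d (M + 1) R B
  set gW : ℕ → ℕ → ℝ := fun j i => weightedFirstVariation (dyadicNode ψ ε V₀ j i)
    (φ ((i : ℝ) / 2 ^ j)) (approxCurvature ψ ε (dyadicNode ψ ε V₀ j i)) with hgW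
  set gT : ℕ → ℕ → ℝ := fun j i => ∫ x, derivWithin (fun s => φ s x) (Icc 0 1) ((i : ℝ) / 2 ^ j)
    ∂(mass (dyadicNode ψ ε V₀ j i)) with hgT
  have hbound : ∀ᶠ j : ℕ in atTop, ∀ t ∈ Icc (0 : ℝ) 1,
      |gW j ⌊t * 2 ^ j⌋₊| ≤ C ∧ |gT j ⌊t * 2 ^ j⌋₊| ≤ C := by
    filter_upwards [hnode] with j hj t ht
    have h := hj _ (floor_mul_two_pow_le ht.2 j)
    exact hC _ _ h (hB _ _ h) _ (dyadicTime j ⟨t, ht⟩).2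
  have hWlim : ∀ t ∈ Icc (0 : ℝ) 1, Tendsto (fun j => gW j ⌊t * 2 ^ j⌋₊) atTop
      (𝓝 (weightedFirstVariation (V t) (φ t) (approxCurvature ψ ε (V t)))) := fun t ht =>
    hφ'.tendsto_weightedFirstVariation hψ hε₀ (hlimN t ht) (hnodeF t ht) (hlim t ht).1
      (tendsto_dyadicTime ⟨t, ht⟩)
  have hTlim : ∀ t ∈ Icc (0 : ℝ) 1, Tendsto (fun j => gT j ⌊t * 2 ^ j⌋₊) atTop
      (𝓝 (∫ x, derivWithin (fun s => φ s x) (Icc 0 1) t ∂(mass (V t)))) := fun t ht =>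
    hφ'.tendsto_integral_derivWithin (hlimN t ht) (hnodeF t ht) (tendsto_dyadicTime ⟨t, ht⟩)
  have hWint := fun {a b : ℝ} => intervalIntegrable_and_tendsto_of_bounded (a := a) (b := b)
    (fun j => measurable_comp_floor (gW j) (2 ^ j))
    (hbound.mono fun j hj t ht => (hj t ht).1) hWlim
  have hTint := fun {a b : ℝ} => intervalIntegrable_and_tendsto_of_bounded (a := a) (b := b)
    (fun j => measurable_comp_floor (gT j) (2 ^ j))
    (hbound.mono fun j hj t ht => (hj t ht).2) hTlim
  -- The discrete flow is tracked from time `0`; the equality on `[a, b]` is the difference of two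
  -- such identities.
  have hident : ∀ t ∈ Icc (0 : ℝ) 1, ∫ x, φ t x ∂(mass (V t)) - ∫ x, φ 0 x ∂(mass V₀) =
      (∫ r in (0 : ℝ)..t, weightedFirstVariation (V r) (φ r) (approxCurvature ψ ε (V r))) +
        ∫ r in (0 : ℝ)..t, ∫ x, derivWithin (fun s => φ s x) (Icc 0 1) r ∂(mass (V r)) := by
    intro t ht
    have hc := (hφ'.contDiff ht).continuous
    have h1 : Tendsto (fun j => ∫ x, φ t x ∂(mass (dyadicFlow ψ ε V₀ j t))) atTop
        (𝓝 (∫ x, φ t x ∂(mass (V t)))) := by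
      simp only [fun U : VMeasure d n => integral_mass (V := U) hc]
      exact (hlim t ht).2 _ (by fun_prop)
    have h2 := (h1.sub_const (∫ x, φ 0 x ∂(mass V₀))).sub
      ((hWint le_rfl ht.1 ht.2).2.add (hTint le_rfl ht.1 ht.2).2)
    -- The defect is the limit of the discrete defects, which are eventually at most `η`, for every
    -- `η > 0`.
    refine eq_of_sub_eq_zero (abs_nonpos_iff.1 (le_of_forall_pos_le_add fun η hη => ?_))
    rw [zero_add]
    refine le_of_tendsto h2.abs ?_
    filter_upwards [hφ'.eventually_abs_dyadicFlow_sub_le hB hnode hη] with j hj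
    have h3 := hj t ht
    have hN : (0 : ℝ) < 2 ^ j := by positivity
    rw [← intervalIntegral.integral_add (intervalIntegrable_comp_floor (gW j) hN ht.1)
      (intervalIntegrable_comp_floor (gT j) hN ht.1)]
    exact h3
  have hata : a ∈ Icc (0 : ℝ) 1 := ⟨ha, hab.trans hb⟩
  have hbtb : b ∈ Icc (0 : ℝ) 1 := ⟨ha.trans hab, hb⟩
  refine ⟨fun t ht => ?_, (hWint ha hab hb).1, (hTint ha hab hb).1, ?_⟩
  · have hVt := (hlim t ht).1
    have := hVt.finite
    have hc := (hφ'.contDiff ht).continuous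
    have hg := continuous_gradient (hφ'.contDiff ht)
    have hA := contDiff_approxCurvature hψ hε₀ (V t)
    have hAc := hA.continuous
    have hdiv := continuous_tangentialDiv (d := d) hA
    exact ⟨hVt.supp.integrable_mass hc, hVt.supp.integrable_mass
      (hφ'.continuous_derivWithin_subtype.comp
        (by fun_prop : Continuous fun x : E n => ((⟨t, ht⟩ : Icc (0 : ℝ) 1), x))),
      hVt.supp.integrable (by fun_prop), hVt.supp.integrable (by fun_prop)⟩
  · have h1 := hident a hata
    have h2 := hident b hbtb
    rw [← intervalIntegral.integral_add_adjacent_intervals (hWint le_rfl ha hata.2).1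
      (hWint ha hab hb).1, ← intervalIntegral.integral_add_adjacent_intervals
      (hTint le_rfl ha hata.2).1 (hTint ha hab hb).1] at h2
    linarith
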